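/- For $n\ge 1$ let $\mathcal M_{2n-1}(\mathbb R)=\{(m_1(\mu),\dots,m_{2n-1}(\mu))\}\subset\mathbb R^{2n-1}$, where $\mu$ runs through the Borel probability measures on $\mathbb R$ having moments $m_j(\mu)=\int x^j\,d\mu$ of all orders. For $\vec m=\vec m_{2n-1}$ in the interior of $\mathcal M_{2n-1}(\mathbb R)$ let $P_0=1,P_1,\dots,P_n$ be the associated monic orthogonal polynomials $$P_k(x)=\det\begin{pmatrix} m_0&\cdots&m_{k-1}&1\\ \vdots&&\vdots&\vdots\\ m_k&\cdots&m_{2k-1}&x^k\end{pmatrix}\Big/\det\,(m_{i+j})_{0\le i,j\le k-1},\qquad m_0=1,$$ and let $b_k=b_k(\vec m)$ $(1\le k\le n)$ and $a_k=a_k(\vec m)$ $(1\le k\le n-1)$ be the coefficients of their three-term recurrence $xP_k=P_{k+1}+b_{k+1}P_k+a_kP_{k-1}$ (with $P_1=x-b_1$), which are determined by $\int x^kP_k\,d\mu=a_1\cdots a_k$ and $\int x^{k+1}P_k\,d\mu=a_1\cdots a_k(b_1+\dots+b_{k+1})$ for any $\mu$ with first moments $\vec m$. For parameters $\gamma_k>-1$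 and $\delta_k>0$ let $h_{2n-1}^{(\gamma,\delta)}$ be the density (with respect to Lebesgue measure, equal to $0$ outside the interior of $\mathcal M_{2n-1}(\mathbb R)$) $$h_{2n-1}^{(\gamma,\delta)}(\vec m)=\prod_{k=1}^n\sqrt{\tfrac{\delta_{2k-1}}{\pi}}\,e^{-\delta_{2k-1}b_k^2}\ \prod_{k=1}^{n-1}\frac{\delta_{2k}^{\gamma_k+2n-2k}}{\Gamma(\gamma_k+2n-2k)}\,a_k^{\gamma_k}e^{-\delta_{2k}a_k}\mathbf 1_{\{a_k>0\}} .$$ **Theorem.** Fix a sequence $(\gamma_k)_{k\ge1}$ with $\gamma_k>-1$. For every $n\ge1$ let the random vector $\vec m_{2n-1}$ have a law with density $h_{2n-1}^{(\gamma,\delta)}$, where $\delta_{2k-1}=n$ for $1\le k\le n$ and $\delta_{2k}=2n$ for $1\le k\le n-1$. For $k\in\mathbb N$ let $\vec m_k^{(n)}$ be the projection of $\vec m_{2n-1}$ onto the first $k$ coordinates ($2n-1\ge k$), and let $\vec m_k(\rho)$ be the vector of the first $k$ moments of the semicircle law $d\rho(x)=\frac1{2\pi}\sqrt{4-x^2}\,\mathbf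 1_{\{-2<x<2\}}\,dx$; it equals the vector of the first $k$ terms of $(0,c_1,0,c_2,\dots)$ with $c_m=\frac1{m+1}\binom{2m}{m}$. Let $D=(d_{i,j})$ be the lower triangular $k\times k$ matrix with $$d_{i,j}=\binom{i}{\frac{i-j}2}-\binom{i}{\frac{i-j}2-1}\quad\text{if } j\le i \text{ and } i+j \text{ is even},$$ and $d_{i,j}=0$ otherwise (where $\binom{i}{-1}=0$). Then $D$ is invertible and $$\sqrt{2n}\,D^{-1}\big(\vec m_k^{(n)}-\vec m_k(\rho)\big)\xrightarrow[n\to\infty]{\mathcal D}\mathcal N_k(0,I_k).$$ -/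

import Mathlib

open MeasureTheory ProbabilityTheory Filter Polynomial
open scoped Topology Matrix

noncomputable section

namespace RandomMoments

/-- The `N`-th moment space `𝓜_N(ℝ)`: all vectors `(m_1(μ), …, m_N(μ))`, where `μ` runs through the
Borel probability measures on `ℝ` with existing moments. The moment of order `i + 1` is stored
in the coordinate `i : Fin N`. -/
def momentSpace (N : ℕ) : Set (Fin N → ℝ) :=
  {m | ∃ μ : Measure ℝ, IsProbabilityMeasure μ ∧ (∀ j : ℕ, Integrable (fun x : ℝ => x ^ j) μ) ∧
    ∀ i : Fin N, m i = ∫ x, x ^ ((i : ℕ) + 1) ∂μ}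

/-- The moment `m_j` read off from a moment vector: `m_0 = 1`, and `m_j` for `1 ≤ j ≤ N` is the
corresponding entry (orders above `N` are never used below; they get the value `0`). -/
def momentOf {N : ℕ} (m : Fin N → ℝ) : ℕ → ℝ
  | 0 => 1
  | j + 1 => if h : j < N then m ⟨j, h⟩ else 0

/-- `∫ p dμ` for a polynomial `p` and a measure `μ` with moment vector `m`. -/
def integralPoly {N : ℕ} (m : Fin N → ℝ) (p : ℝ[X]) : ℝ :=
  p.sum fun j c => c * momentOf m j

/-- The monic orthogonal polynomial `P_k` associated with a moment vector: the determinant of the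
`(k+1) × (k+1)` matrix with rows `(m_i, …, m_{i+k-1}, x^i)`, `i = 0, …, k`, divided by the Hankel
determinant `det (m_{i+j})_{0 ≤ i, j ≤ k-1}`. -/
def orthoPoly {N : ℕ} (m : Fin N → ℝ) (k : ℕ) : ℝ[X] :=
  C (Matrix.of fun i j : Fin k => momentOf m ((i : ℕ) + j)).det⁻¹ *
    (Matrix.of fun i j : Fin (k + 1) =>
      if (j : ℕ) < k then C (momentOf m ((i : ℕ) + j)) else X ^ (i : ℕ)).det

/-- `∫ x^k P_k dμ`, which equals `a_1 ⋯ a_k`. -/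
def wallA {N : ℕ} (m : Fin N → ℝ) (k : ℕ) : ℝ :=
  integralPoly m (X ^ k * orthoPoly m k)

/-- `∫ x^{k+1} P_k dμ`, which equals `a_1 ⋯ a_k (b_1 + ⋯ + b_{k+1})`. -/
def wallB {N : ℕ} (m : Fin N → ℝ) (k : ℕ) : ℝ :=
  integralPoly m (X ^ (k + 1) * orthoPoly m k)

/-- The coefficient `a_k`, `k ≥ 1`, of the three-term recurrence
`x P_k = P_{k+1} + b_{k+1} P_k + a_k P_{k-1}`, determined by `∫ x^k P_k dμ = a_1 ⋯ a_k`. -/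
def recA {N : ℕ} (m : Fin N → ℝ) (k : ℕ) : ℝ :=
  wallA m k / wallA m (k - 1)

/-- The coefficient `b_k`, `k ≥ 1`, of the three-term recurrence, determined by
`∫ x^{k+1} P_k dμ = a_1 ⋯ a_k (b_1 + ⋯ + b_{k+1})` for `k ≥ 0`. -/
def recB {N : ℕ} (m : Fin N → ℝ) (k : ℕ) : ℝ :=
  wallB m (k - 1) / wallA m (k - 1) - if k = 1 then 0 else wallB m (k - 2) / wallA m (k - 2)

open Classical in
/-- The density `h_{2n-1}^{(γ,δ)}` on the moment space `𝓜_{2n-1}(ℝ)` (with respect to Lebesgue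
measure; the recursion coefficients live on the interior, and the boundary is a null set). -/
def density (γ δ : ℕ → ℝ) (n : ℕ) (m : Fin (2 * n - 1) → ℝ) : ℝ :=
  if m ∈ interior (momentSpace (2 * n - 1)) then
    (∏ k ∈ Finset.Icc 1 n,
      √(δ (2 * k - 1) / Real.pi) * Real.exp (-δ (2 * k - 1) * recB m k ^ 2)) *
    ∏ k ∈ Finset.Icc 1 (n - 1),
      δ (2 * k) ^ (γ k + 2 * n - 2 * k) / Real.Gamma (γ k + 2 * n - 2 * k) *
        recA m k ^ γ k * Real.exp (-δ (2 * k) * recA m k) * (if 0 < recA m k then 1 else 0)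
  else 0

/-- The probability distribution on `ℝ^{2n-1}` with Lebesgue density `h_{2n-1}^{(γ,δ)}`. -/
def momentLaw (γ δ : ℕ → ℝ) (n : ℕ) : Measure (Fin (2 * n - 1) → ℝ) :=
  volume.withDensity fun m => ENNReal.ofReal (density γ δ n m)

/-- Wigner's semicircle law `ρ` on `[-2, 2]`. -/
def semicircle : Measure ℝ :=
  volume.withDensity fun x => ENNReal.ofReal
    ((Set.Ioo (-2 : ℝ) 2).indicator (fun x => 1 / (2 * Real.pi) * √(4 - x ^ 2)) x)

/-- The vector `(m_1(ρ), …, m_k(ρ))` of the first `k` moments of the semicircle law. -/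
def semicircleMoments (k : ℕ) : Fin k → ℝ :=
  fun i => ∫ x, x ^ ((i : ℕ) + 1) ∂semicircle

/-- The projection onto the first `k` coordinates of `ℝ^N`. It is used for `k ≤ N`; if `k > N`,
the missing coordinates are filled with `0`. -/
def proj (k : ℕ) {N : ℕ} (m : Fin N → ℝ) : Fin k → ℝ :=
  fun i => if h : (i : ℕ) < N then m ⟨i, h⟩ else 0

/-- The number `binom(i, (i-j)/2) - binom(i, (i-j)/2 - 1)` if `j ≤ i` and `i + j` is even, and
`0` otherwise. Here `binom(i, -1) = 0`. -/
def entryD (i j : ℕ) : ℝ :=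
  if j ≤ i ∧ Even (i + j) then
    (i.choose ((i - j) / 2) : ℝ) - if i = j then 0 else (i.choose ((i - j) / 2 - 1) : ℝ)
  else 0

/-- The lower triangular matrix `D = (d_{i,j})_{1 ≤ i, j ≤ k}`. -/
def matD (k : ℕ) : Matrix (Fin k) (Fin k) ℝ :=
  Matrix.of fun i j => entryD ((i : ℕ) + 1) ((j : ℕ) + 1)

end RandomMoments

end

noncomputable section

namespace RandomMoments

/-! The proof works in the coordinates x = (b_1, a_1, b_2, a_2, …), in which the law is a product.
The moment m_j is the total weight of closed Motzkin paths of length j (`pathWeight`). Cutting such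
paths in two factorises the Hankel matrices (`pathWeight_add_eq_sum`, `det_moment_lastColumn`), so
the determinantal `recA` and `recB` recover x from the moments. The moment map has a triangular
Jacobian with determinant ∏ a_k^(2n-2k-1) (`det_fderiv_momentMap`, `prod_downProd`). This is exactly
the power that turns h into a product of N(0, 1/(2n)) densities in the b_k and Gamma densities of
shape γ_k+2n-2k and rate 2n in the a_k (`momentLaw_eq_map`).

Centred at the coefficients b = 0, a = 1 of the semicircle law and scaled by √(2n), the first k
coordinates are independent, and characteristic functions show that they tend to N_k(0, I)
(`tendsto_map_normalizedVector`).

The passage to moments is an exact Duhamel formula (`pathWeight_sub_ballot`): if x = free + εz, then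
(m(x) - m(ρ))/ε is a polynomial in (z, ε). At ε = 0 it equals Dz, because a last-passage
decomposition evaluates the linear part in ballot numbers (`perturbedStep_freeCoeff`), which are the
entries of D. So the normalised moment vector is G(z_n, 1/√(2n)) with G continuous and G(z, 0) = z,
and the continuous mapping theorem concludes. -/

/-! ### Weighted Motzkin paths -/

/-- The total weight of the Motzkin paths of length `j` from height `0` to height `h`, where a
level step at height `l` has weight `x (2 * l)`, a down step from height `l + 1` to height `l` has
weight `x (2 * l + 1)`, and up steps have weight `1`. -/
def pathWeight (x : ℕ → ℝ) : ℕ → ℕ → ℝ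
  | 0, 0 => 1
  | 0, _ + 1 => 0
  | j + 1, 0 => x 0 * pathWeight x j 0 + x 1 * pathWeight x j 1
  | j + 1, h + 1 => pathWeight x j h + x (2 * (h + 1)) * pathWeight x j (h + 1) +
      x (2 * (h + 1) + 1) * pathWeight x j (h + 2)

theorem pathWeight_of_lt (x : ℕ → ℝ) : ∀ {j h : ℕ}, j < h → pathWeight x j h = 0
  | 0, h + 1, _ => by simp [pathWeight]
  | j + 1, h + 1, hj => by
    have h1 : j < h := by omega
    simp [pathWeight, pathWeight_of_lt x h1, pathWeight_of_lt x (show j < h + 1 by omega),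
      pathWeight_of_lt x (show j < h + 2 by omega)]

theorem pathWeight_self (x : ℕ → ℝ) : ∀ j : ℕ, pathWeight x j j = 1
  | 0 => by simp [pathWeight]
  | j + 1 => by
    simp [pathWeight, pathWeight_self x j, pathWeight_of_lt x (show j < j + 1 by omega),
      pathWeight_of_lt x (show j < j + 2 by omega)]

/-- Such a path has j up steps and a single level step, which may sit at any height 0, …, j. This is
the source of b_1 + ⋯ + b_{j+1}. -/
theorem pathWeight_succ_self (x : ℕ → ℝ) :
    ∀ j : ℕ, pathWeight x (j + 1) j = ∑ l ∈ Finset.range (j + 1), x (2 * l)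
  | 0 => by simp [pathWeight]
  | j + 1 => by
    rw [Finset.sum_range_succ, ← pathWeight_succ_self x j]
    rw [pathWeight, pathWeight_self, pathWeight_of_lt x (show j + 1 < j + 2 by omega)]
    ring

/-- A path that uses a step at height l ≥ h must climb there and come back to h; its length then
bounds the index of the weight by j + h. -/
theorem pathWeight_congr {x y : ℕ → ℝ} :
    ∀ {j h : ℕ}, (∀ i, i < j + h → x i = y i) → pathWeight x j h = pathWeight y j h
  | 0, 0, _ => by simp [pathWeight]
  | 0, h + 1, _ => by simp [pathWeight]
  | j + 1, 0, hxy => by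
    rcases Nat.eq_zero_or_pos j with rfl | hj
    · simp [pathWeight, hxy 0 (by omega)]
    · simp [pathWeight, hxy 0 (by omega), hxy 1 (by omega),
        pathWeight_congr (j := j) (h := 0) fun i hi => hxy i (by omega),
        pathWeight_congr (j := j) (h := 1) fun i hi => hxy i (by omega)]
  | j + 1, h + 1, hxy => by
    have e1 := pathWeight_congr (j := j) (h := h) fun i hi => hxy i (by omega)
    have e2 := pathWeight_congr (j := j) (h := h + 1) fun i hi => hxy i (by omega)
    have e3 := pathWeight_congr (j := j) (h := h + 2) fun i hi => hxy i (by omega)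
    simp only [pathWeight]
    rw [e1, e2, e3]
    congr 1
    · congr 1
      -- If the height is out of reach, the path weight vanishes and the values of x and y there are
      -- irrelevant.
      rcases lt_or_ge j (h + 1) with hj | hj
      · rw [pathWeight_of_lt y hj, mul_zero, mul_zero]
      · rw [hxy (2 * (h + 1)) (by omega)]
    · rcases lt_or_ge j (h + 2) with hj | hj
      · rw [pathWeight_of_lt y hj, mul_zero, mul_zero]
      · rw [hxy (2 * (h + 1) + 1) (by omega)]

theorem continuous_pathWeight : ∀ j h : ℕ, Continuous fun x : ℕ → ℝ => pathWeight x j h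
  | 0, 0 => by simpa [pathWeight] using continuous_const
  | 0, h + 1 => by simpa [pathWeight] using continuous_const
  | j + 1, 0 => by
    have h0 := continuous_pathWeight j 0
    have h1 := continuous_pathWeight j 1
    simp only [pathWeight]
    fun_prop
  | j + 1, h + 1 => by
    have h0 := continuous_pathWeight j h
    have h1 := continuous_pathWeight j (h + 1)
    have h2 := continuous_pathWeight j (h + 2)
    simp only [pathWeight]
    fun_prop

/-- The product of the weights of the down steps from height `h` to height `0`. -/
def downProd (x : ℕ → ℝ) (h : ℕ) : ℝ := ∏ l ∈ Finset.range h, x (2 * l + 1)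

theorem downProd_succ (x : ℕ → ℝ) (h : ℕ) : downProd x (h + 1) = downProd x h * x (2 * h + 1) :=
  Finset.prod_range_succ _ _

/-- The tridiagonal step operator is symmetric for the weights `downProd`, so moving one step from
one factor to the other telescopes to a boundary term, as in a discrete Green formula. -/
theorem sum_pathWeight_succ_sub (x : ℕ → ℝ) (i j n : ℕ) :
    ∑ h ∈ Finset.range (n + 1), (pathWeight x (i + 1) h * downProd x h * pathWeight x j h -
        pathWeight x i h * downProd x h * pathWeight x (j + 1) h) =
      downProd x (n + 1) * (pathWeight x i (n + 1) * pathWeight x j n -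
        pathWeight x i n * pathWeight x j (n + 1)) := by
  induction n with
  | zero => simp [pathWeight, downProd]; ring
  | succ n ih =>
    rw [Finset.sum_range_succ, ih, downProd_succ x (n + 1)]
    simp only [pathWeight]
    ring

/-- Splitting a closed path of length `i + j` at time `i`. -/
theorem pathWeight_add_eq_sum (x : ℕ → ℝ) {n : ℕ} :
    ∀ {i : ℕ} (j : ℕ), i < n → pathWeight x (i + j) 0 =
      ∑ h ∈ Finset.range n, pathWeight x i h * downProd x h * pathWeight x j h := by
  have aux : ∀ (i j N : ℕ), i + j < N → pathWeight x (i + j) 0 =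
      ∑ h ∈ Finset.range N, pathWeight x i h * downProd x h * pathWeight x j h := by
    intro i
    induction i with
    | zero =>
      intro j N hN
      rw [Finset.sum_eq_single 0]
      · simp [pathWeight, downProd]
      · intro h _ hh
        rw [pathWeight_of_lt x (Nat.pos_of_ne_zero hh), zero_mul, zero_mul]
      · intro h0
        exact absurd (Finset.mem_range.2 (by omega)) h0
    | succ i ih =>
      intro j N hN
      obtain ⟨N, rfl⟩ : ∃ N', N = N' + 1 := ⟨N - 1, by omega⟩
      -- The cut moves from time i to time i + 1; the boundary term vanishes because height N + 1 is
      -- out of reach.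
      have h1 := sum_pathWeight_succ_sub x i j N
      rw [pathWeight_of_lt x (show i < N + 1 by omega), pathWeight_of_lt x (show j < N + 1 by omega),
        Finset.sum_sub_distrib] at h1
      rw [show i + 1 + j = i + (j + 1) by ring, ih (j + 1) (N + 1) (by omega)]
      linarith
  intro i j hi
  rw [aux i j (max n (i + j + 1)) (by omega)]
  symm
  apply Finset.sum_subset
  · intro a ha
    rw [Finset.mem_range] at *
    omega
  · intro a _ ha
    rw [Finset.mem_range] at ha
    rw [pathWeight_of_lt x (show i < a by omega), zero_mul, zero_mul]

/-! ### Hankel determinants -/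

/-- Splitting paths at time i writes the matrix as L · diag(`downProd`) · Rᵀ with L and R
triangular. All diagonal entries are 1 except the last one of R, which is `pathWeight x e k`. -/
theorem det_moment_lastColumn (x : ℕ → ℝ) (k e : ℕ) :
    (Matrix.of fun i j : Fin (k + 1) =>
      pathWeight x ((i : ℕ) + if (j : ℕ) < k then (j : ℕ) else e) 0).det =
      (∏ h ∈ Finset.range (k + 1), downProd x h) * pathWeight x e k := by
  set L : Matrix (Fin (k + 1)) (Fin (k + 1)) ℝ := Matrix.of fun i h => pathWeight x i h with hL
  set R : Matrix (Fin (k + 1)) (Fin (k + 1)) ℝ :=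
    Matrix.of fun j h => pathWeight x (if (j : ℕ) < k then (j : ℕ) else e) h with hR
  have key : (Matrix.of fun i j : Fin (k + 1) =>
      pathWeight x ((i : ℕ) + if (j : ℕ) < k then (j : ℕ) else e) 0) =
      L * Matrix.diagonal (fun h : Fin (k + 1) => downProd x h) * Rᵀ := by
    ext i j
    rw [Matrix.mul_apply]
    simp only [Matrix.mul_diagonal, Matrix.transpose_apply, hL, hR, Matrix.of_apply]
    rw [pathWeight_add_eq_sum x _ i.2, Finset.sum_range]
  have dL : L.det = 1 := by
    rw [Matrix.det_of_isLowerTriangular]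
    · simp [hL, pathWeight_self]
    · intro i j hij
      exact pathWeight_of_lt x hij
  have dR : R.det = pathWeight x e k := by
    rw [Matrix.det_of_isLowerTriangular]
    · rw [Fin.prod_univ_castSucc]
      simp [hR, pathWeight_self]
    · intro i j hij
      have h1 : (i : ℕ) < j := hij
      have h2 := j.2
      simp only [hR, Matrix.of_apply]
      rw [if_pos (by omega)]
      exact pathWeight_of_lt x hij
  rw [key, Matrix.det_mul, Matrix.det_mul, dL, Matrix.det_transpose, dR, Matrix.det_diagonal,
    one_mul, Finset.prod_range]

theorem det_hankel (x : ℕ → ℝ) (k : ℕ) :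
    (Matrix.of fun i j : Fin k => pathWeight x ((i : ℕ) + j) 0).det =
      ∏ h ∈ Finset.range k, downProd x h := by
  cases k with
  | zero => simp
  | succ k =>
    rw [← mul_one (∏ h ∈ Finset.range (k + 1), downProd x h), ← pathWeight_self x k,
      ← det_moment_lastColumn]
    congr 1
    ext i j
    simp only [Matrix.of_apply]
    congr 2
    have := j.2
    split_ifs <;> omega

/-- Only the last column of the determinant contains X, so the integral acts linearly on it. Both
sides are expanded along that column. -/
theorem integralPoly_X_pow_mul_orthoPoly {N : ℕ} (m : Fin N → ℝ) (e k : ℕ) :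
    integralPoly m (X ^ e * orthoPoly m k) =
      (Matrix.of fun i j : Fin k => momentOf m ((i : ℕ) + j)).det⁻¹ *
        (Matrix.of fun i j : Fin (k + 1) =>
          momentOf m ((i : ℕ) + if (j : ℕ) < k then (j : ℕ) else e)).det := by
  have hlin : ∀ p, integralPoly m p =
      Polynomial.lsum (fun j => LinearMap.mulRight ℝ (momentOf m j)) p := by
    intro p
    rw [Polynomial.lsum_apply]
    rfl
  have hmono : ∀ (c : ℝ) (j : ℕ), integralPoly m (C c * X ^ j) = c * momentOf m j := by
    intro c j
    rw [integralPoly, C_mul_X_pow_eq_monomial, sum_monomial_index _ _ (by simp)]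
  rw [orthoPoly, Matrix.det_succ_column _ (Fin.last k), Matrix.det_succ_column _ (Fin.last k)]
  have hterm : ∀ i : Fin (k + 1), X ^ e * (C (Matrix.of fun i j : Fin k =>
      momentOf m ((i : ℕ) + j)).det⁻¹ * ((-1) ^ ((i : ℕ) + (Fin.last k : ℕ)) *
        (Matrix.of fun i j : Fin (k + 1) =>
          if (j : ℕ) < k then C (momentOf m ((i : ℕ) + j)) else X ^ (i : ℕ)) i (Fin.last k) *
        ((Matrix.of fun i j : Fin (k + 1) =>
          if (j : ℕ) < k then C (momentOf m ((i : ℕ) + j)) else X ^ (i : ℕ)).submatrix i.succAbove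
          (Fin.last k).succAbove).det)) =
      C ((Matrix.of fun i j : Fin k => momentOf m ((i : ℕ) + j)).det⁻¹ *
        ((-1) ^ ((i : ℕ) + (Fin.last k : ℕ)) * ((Matrix.of fun i j : Fin (k + 1) =>
          momentOf m ((i : ℕ) + if (j : ℕ) < k then (j : ℕ) else e)).submatrix i.succAbove
          (Fin.last k).succAbove).det)) * X ^ ((i : ℕ) + e) := by
    intro i
    have hd : ((Matrix.of fun i j : Fin (k + 1) =>
          if (j : ℕ) < k then C (momentOf m ((i : ℕ) + j)) else X ^ (i : ℕ)).submatrix i.succAbove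
          (Fin.last k).succAbove).det = C ((Matrix.of fun i j : Fin (k + 1) =>
          momentOf m ((i : ℕ) + if (j : ℕ) < k then (j : ℕ) else e)).submatrix i.succAbove
          (Fin.last k).succAbove).det := by
      rw [RingHom.map_det]
      congr 1
      ext1 a b
      simp
    rw [hd]
    simp only [Matrix.of_apply, Fin.val_last, lt_irrefl, if_false, C_mul, C_pow, C_neg, C_1]
    ring
  rw [Finset.mul_sum, Finset.mul_sum, Finset.mul_sum, hlin, map_sum]
  refine Finset.sum_congr rfl fun i _ => ?_
  rw [hterm, ← hlin, hmono]
  simp only [Matrix.of_apply, Fin.val_last, lt_irrefl, if_false]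
  ring

/-! ### Moments as functions of the recursion coefficients -/

/-- The extension of a vector by zeros to a sequence. -/
def zeroExtend {N : ℕ} (x : Fin N → ℝ) : ℕ → ℝ :=
  fun i => if h : i < N then x ⟨i, h⟩ else 0

theorem zeroExtend_of_lt {N : ℕ} (x : Fin N → ℝ) {i : ℕ} (h : i < N) :
    zeroExtend x i = x ⟨i, h⟩ := dif_pos h

theorem zeroExtend_of_le {N : ℕ} (x : Fin N → ℝ) {i : ℕ} (h : N ≤ i) :
    zeroExtend x i = 0 := dif_neg (by omega)

@[simp]
theorem zeroExtend_coe {N : ℕ} (x : Fin N → ℝ) (i : Fin N) : zeroExtend x i = x i :=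
  zeroExtend_of_lt x i.2

theorem continuous_zeroExtend {N : ℕ} : Continuous (zeroExtend (N := N)) := by
  refine continuous_pi fun i => ?_
  by_cases h : i < N
  · simpa only [zeroExtend_of_lt _ h] using continuous_apply _
  · simpa only [zeroExtend_of_le _ (not_lt.1 h)] using continuous_const

/-- The map from the recursion coefficients `(b_1, a_1, b_2, a_2, …)` to the moments. -/
def momentMap (N : ℕ) (x : Fin N → ℝ) : Fin N → ℝ :=
  fun i => pathWeight (zeroExtend x) (i + 1) 0

theorem momentOf_momentMap {N : ℕ} (x : Fin N → ℝ) {j : ℕ} (hj : j ≤ N) :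
    momentOf (momentMap N x) j = pathWeight (zeroExtend x) j 0 := by
  cases j with
  | zero => simp [momentOf, pathWeight]
  | succ j => simp [momentOf, momentMap, show j < N by omega]

/-- In the quotient of the two determinants only the factor of height k survives. The bounds on 2k
and k + e keep every moment order at most N, away from the default values of `momentOf`. -/
theorem integralPoly_momentMap {N e k : ℕ} (x : Fin N → ℝ) (hk : 2 * k ≤ N) (he : k + e ≤ N)
    (hx : ∀ h < k, downProd (zeroExtend x) h ≠ 0) :
    integralPoly (momentMap N x) (X ^ e * orthoPoly (momentMap N x) k) =
      downProd (zeroExtend x) k * pathWeight (zeroExtend x) e k := by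
  have h1 : (Matrix.of fun i j : Fin k => momentOf (momentMap N x) ((i : ℕ) + j)) =
      Matrix.of fun i j : Fin k => pathWeight (zeroExtend x) ((i : ℕ) + j) 0 := by
    ext i j
    have := i.2
    have := j.2
    exact momentOf_momentMap x (by omega)
  have h2 : (Matrix.of fun i j : Fin (k + 1) =>
      momentOf (momentMap N x) ((i : ℕ) + if (j : ℕ) < k then (j : ℕ) else e)) =
      Matrix.of fun i j : Fin (k + 1) =>
        pathWeight (zeroExtend x) ((i : ℕ) + if (j : ℕ) < k then (j : ℕ) else e) 0 := by
    ext i j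
    have := i.2
    have := j.2
    refine momentOf_momentMap x ?_
    split_ifs <;> omega
  have h3 : ∏ h ∈ Finset.range k, downProd (zeroExtend x) h ≠ 0 :=
    Finset.prod_ne_zero_iff.2 fun h hh => hx h (Finset.mem_range.1 hh)
  rw [integralPoly_X_pow_mul_orthoPoly, h1, h2, det_hankel, det_moment_lastColumn,
    Finset.prod_range_succ]
  field_simp

/-- The vectors of recursion coefficients with positive `a_k`. -/
def positiveCoeffs (N : ℕ) : Set (Fin N → ℝ) := {x | ∀ i : Fin N, Odd (i : ℕ) → 0 < x i}

theorem isOpen_positiveCoeffs (N : ℕ) : IsOpen (positiveCoeffs N) := by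
  simp only [positiveCoeffs, Set.ofPred_forall]
  exact isOpen_iInter_of_finite fun i => isOpen_iInter_of_finite fun _ =>
    isOpen_lt continuous_const (continuous_apply i)

theorem downProd_pos {N : ℕ} {x : Fin N → ℝ} (hx : x ∈ positiveCoeffs N) {h : ℕ}
    (hh : 2 * h ≤ N) : 0 < downProd (zeroExtend x) h := by
  refine Finset.prod_pos fun l hl => ?_
  rw [Finset.mem_range] at hl
  rw [zeroExtend_of_lt x (by omega : 2 * l + 1 < N)]
  exact hx _ ⟨l, rfl⟩

theorem recA_momentMap {N k : ℕ} {x : Fin N → ℝ} (hx : x ∈ positiveCoeffs N)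
    (hk : 2 * (k + 1) ≤ N) : recA (momentMap N x) (k + 1) = zeroExtend x (2 * k + 1) := by
  have hA : ∀ l, 2 * l ≤ N → wallA (momentMap N x) l = downProd (zeroExtend x) l := fun l hl => by
    rw [wallA, integralPoly_momentMap x hl (by omega) fun h hh =>
      (downProd_pos hx (by omega)).ne', pathWeight_self, mul_one]
  have h0 := (downProd_pos hx (show 2 * k ≤ N by omega)).ne'
  rw [recA, Nat.add_sub_cancel, hA _ hk, hA k (by omega), downProd_succ]
  field_simp

theorem recB_momentMap {N k : ℕ} {x : Fin N → ℝ} (hx : x ∈ positiveCoeffs N)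
    (hk : 2 * k + 1 ≤ N) : recB (momentMap N x) (k + 1) = zeroExtend x (2 * k) := by
  have hB : ∀ l, 2 * l + 1 ≤ N → wallB (momentMap N x) l / wallA (momentMap N x) l =
      ∑ i ∈ Finset.range (l + 1), zeroExtend x (2 * i) := fun l hl => by
    have h0 := (downProd_pos hx (show 2 * l ≤ N by omega)).ne'
    rw [wallA, wallB, integralPoly_momentMap x (by omega) (by omega) fun h hh =>
      (downProd_pos hx (by omega)).ne', integralPoly_momentMap x (by omega) (by omega) fun h hh =>
      (downProd_pos hx (by omega)).ne', pathWeight_self, pathWeight_succ_self]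
    field_simp
  rw [recB, Nat.add_sub_cancel, hB k hk]
  cases k with
  | zero => simp
  | succ k =>
    rw [if_neg (by omega), show k + 1 + 1 - 2 = k by omega, hB k (by omega),
      Finset.sum_range_succ]
    ring

/-- `recA` and `recB` provide a left inverse. -/
theorem injOn_momentMap (N : ℕ) : Set.InjOn (momentMap N) (positiveCoeffs N) := by
  intro x hx y hy hxy
  ext i
  rcases Nat.even_or_odd' (i : ℕ) with ⟨k, hk | hk⟩
  · have h1 := recB_momentMap (k := k) hx (by omega)
    have h2 := recB_momentMap (k := k) hy (by omega)
    rw [← hk, zeroExtend_coe] at h1 h2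
    rw [← h1, ← h2, hxy]
  · have h1 := recA_momentMap (k := k) hx (by omega)
    have h2 := recA_momentMap (k := k) hy (by omega)
    rw [← hk, zeroExtend_coe] at h1 h2
    rw [← h1, ← h2, hxy]

/-! ### The free case and first order perturbation -/

/-- The recursion coefficients of the semicircle law. -/
def freeCoeff (i : ℕ) : ℝ := if Even i then 0 else 1

theorem freeCoeff_two_mul (h : ℕ) : freeCoeff (2 * h) = 0 := by simp [freeCoeff]

theorem freeCoeff_two_mul_add_one (h : ℕ) : freeCoeff (2 * h + 1) = 1 := by
  simp [freeCoeff]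

/-- The number of nonnegative paths of length `i` with steps `± 1` from height `0` to `j`. -/
def ballot (i j : ℕ) : ℝ := pathWeight freeCoeff i j

@[simp] theorem ballot_zero_zero : ballot 0 0 = 1 := by simp [ballot, pathWeight]

@[simp] theorem ballot_zero_succ (h : ℕ) : ballot 0 (h + 1) = 0 := by simp [ballot, pathWeight]

theorem ballot_succ_zero (i : ℕ) : ballot (i + 1) 0 = ballot i 1 := by
  simp [ballot, pathWeight, freeCoeff]

theorem ballot_succ_succ (i h : ℕ) : ballot (i + 1) (h + 1) = ballot i h + ballot i (h + 2) := by
  simp [ballot, pathWeight, freeCoeff_two_mul, freeCoeff_two_mul_add_one]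

theorem ballot_of_lt {i j : ℕ} (h : i < j) : ballot i j = 0 := pathWeight_of_lt _ h

theorem ballot_of_odd : ∀ {i j : ℕ}, Odd (i + j) → ballot i j = 0
  | 0, 0, h => by simp at h
  | 0, j + 1, _ => ballot_zero_succ j
  | i + 1, 0, h => by
    rw [ballot_succ_zero]
    exact ballot_of_odd h
  | i + 1, j + 1, h => by
    rw [ballot_succ_succ, ballot_of_odd (i := i) (j := j) (by grind),
      ballot_of_odd (i := i) (j := j + 2) (by grind), add_zero]

/-- The reflection formula with m down steps. It follows by induction, since both sides satisfy
Pascal's rule and agree at the wall. -/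
theorem ballot_eq_choose_sub_choose : ∀ {i j : ℕ} (m : ℕ), i = 2 * m + j →
    ballot i j = (i.choose m : ℝ) - if m = 0 then 0 else (i.choose (m - 1) : ℝ)
  | 0, j, m, h => by
    obtain ⟨rfl, rfl⟩ : m = 0 ∧ j = 0 := by omega
    simp
  | i + 1, 0, m, h => by
    obtain ⟨m, rfl⟩ : ∃ m', m = m' + 1 := ⟨m - 1, by omega⟩
    have hi : i = 2 * m + 1 := by omega
    rw [ballot_succ_zero, ballot_eq_choose_sub_choose m hi]
    -- The row i = 2m + 1 is odd, so its two middle binomial coefficients coincide.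
    have hs : i.choose (m + 1) = i.choose m := by
      rw [← Nat.choose_symm (show m ≤ i by omega)]
      congr 1
      omega
    rw [Nat.choose_succ_succ', hs]
    cases m with
    | zero => norm_num
    | succ m =>
      simp only [Nat.add_eq_zero_iff, one_ne_zero, and_false, if_false, Nat.add_sub_cancel]
      rw [Nat.choose_succ_succ']
      push_cast
      ring
  | i + 1, j + 1, 0, h => by
    obtain rfl : i = j := by omega
    simp [ballot, pathWeight_self]
  | i + 1, j + 1, 1, h => by
    rw [ballot_succ_succ, ballot_eq_choose_sub_choose 1 (show i = 2 * 1 + j by omega),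
      ballot_eq_choose_sub_choose 0 (show i = 2 * 0 + (j + 2) by omega)]
    simp
  | i + 1, j + 1, m + 2, h => by
    rw [ballot_succ_succ, ballot_eq_choose_sub_choose (m + 2) (show i = 2 * (m + 2) + j by omega),
      ballot_eq_choose_sub_choose (m + 1) (show i = 2 * (m + 1) + (j + 2) by omega)]
    simp only [Nat.add_eq_zero_iff, one_ne_zero, and_false, if_false, OfNat.ofNat_ne_zero,
      Nat.add_sub_cancel, show m + 2 - 1 = m + 1 by omega]
    rw [Nat.choose_succ_succ' i (m + 1), Nat.choose_succ_succ' i m]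
    push_cast
    ring

theorem entryD_eq_ballot (i j : ℕ) : entryD i j = ballot i j := by
  unfold entryD
  split_ifs with h1 h2
  · subst h2
    simp [ballot, pathWeight_self]
  · obtain ⟨m, hm⟩ : ∃ m, i = 2 * m + j := ⟨(i - j) / 2, by obtain ⟨_, c, hc⟩ := h1; omega⟩
    rw [ballot_eq_choose_sub_choose m hm, if_neg (by omega), show (i - j) / 2 = m by omega]
  · rcases lt_or_ge i j with h | h
    · rw [ballot_of_lt h]
    · rw [ballot_of_odd]
      rw [← Nat.not_even_iff_odd]
      tauto

theorem det_matD (k : ℕ) : (matD k).det = 1 := by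
  rw [Matrix.det_of_isLowerTriangular]
  · simp [matD, entryD_eq_ballot, ballot, pathWeight_self]
  · intro i j hij
    have h1 : (i : ℕ) < j := hij
    simp only [matD, Matrix.of_apply, entryD_eq_ballot]
    exact ballot_of_lt (by omega)

/-- Last-passage decomposition: a path from 0 to p + q + 1 leaves height p upwards for a last time,
and what follows is a nonnegative path seen from height p + 1. The proof is an induction that peels
a step off the first factor. -/
theorem sum_antidiagonal_ballot_mul (i p q : ℕ) :
    ∑ st ∈ Finset.HasAntidiagonal.antidiagonal i, ballot st.1 p * ballot st.2 q = ballot (i + 1) (p + q + 1) := by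
  induction i generalizing p with
  | zero =>
    rw [ballot_succ_succ]
    cases p <;> cases q <;> simp [ballot_of_lt]
  | succ i ih =>
    rw [Finset.Nat.sum_antidiagonal_succ]
    cases p with
    | zero =>
      simp only [ballot_succ_zero, ballot_zero_zero, one_mul]
      rw [ih, ballot_succ_succ (i + 1), zero_add, show 1 + q + 1 = q + 2 by ring]
    | succ p =>
      simp only [ballot_succ_succ _ p, ballot_zero_succ, zero_mul, zero_add, add_mul,
        Finset.sum_add_distrib]
      rw [ih, ih, ballot_succ_succ (i + 1), show p + 1 + q = p + q + 1 by ring,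
        show p + 2 + q + 1 = p + q + 1 + 2 by ring]

/-- The same telescoping as in `sum_pathWeight_succ_sub`, now between the step operator of x and the
free one. Besides the boundary term, the difference of the two operators remains. -/
theorem sum_pathWeight_mul_ballot_sub (x : ℕ → ℝ) (s t n : ℕ) :
    ∑ h ∈ Finset.range (n + 1),
        (pathWeight x (s + 1) h * ballot t h - pathWeight x s h * ballot (t + 1) h) =
      ∑ h ∈ Finset.range (n + 1), ((x - freeCoeff) (2 * h) * pathWeight x s h +
        (x - freeCoeff) (2 * h + 1) * pathWeight x s (h + 1)) * ballot t h +
      (pathWeight x s (n + 1) * ballot t n - pathWeight x s n * ballot t (n + 1)) := by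
  induction n with
  | zero =>
    simp [pathWeight, ballot_succ_zero, freeCoeff]
    ring
  | succ n ih =>
    rw [Finset.sum_range_succ, ih, Finset.sum_range_succ _ (n + 1)]
    simp only [pathWeight, ballot_succ_succ, Pi.sub_apply, freeCoeff_two_mul,
      freeCoeff_two_mul_add_one]
    ring

/-- The sum over all positions of one perturbed step in a path of length `i + 1`, where the path
has weights `x` before that step and free weights after it. -/
def perturbedStep (x y : ℕ → ℝ) (i : ℕ) : ℝ :=
  ∑ st ∈ Finset.HasAntidiagonal.antidiagonal i, ∑ h ∈ Finset.range (i + 1),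
    (y (2 * h) * pathWeight x st.1 h + y (2 * h + 1) * pathWeight x st.1 (h + 1)) * ballot st.2 h

/-- Duhamel's formula: E(s, t) counts paths with s steps of weight x followed by t free steps, and
the switching time is moved from one end to the other. The identity is exact, so no Taylor remainder
has to be estimated. -/
theorem pathWeight_sub_ballot (x : ℕ → ℝ) (i : ℕ) :
    pathWeight x (i + 1) 0 - ballot (i + 1) 0 = perturbedStep x (x - freeCoeff) i := by
  set E : ℕ × ℕ → ℝ := fun st =>
    ∑ h ∈ Finset.range (i + 1), pathWeight x st.1 h * ballot st.2 h with hE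
  have e1 : E (i + 1, 0) = pathWeight x (i + 1) 0 := by
    simp only [hE]
    rw [Finset.sum_eq_single 0 (fun h _ hh => by
      rw [ballot_of_lt (Nat.pos_of_ne_zero hh), mul_zero]) (by simp)]
    simp
  have e2 : E (0, i + 1) = ballot (i + 1) 0 := by
    simp only [hE]
    rw [Finset.sum_eq_single 0 (fun h _ hh => by
      rw [pathWeight_of_lt x (Nat.pos_of_ne_zero hh), zero_mul]) (by simp)]
    simp [pathWeight]
  have h1 := Finset.Nat.sum_antidiagonal_succ (n := i) (f := E)
  have h2 := Finset.Nat.sum_antidiagonal_succ' (n := i) (f := E)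
  rw [e1] at h2
  rw [e2] at h1
  have h3 : ∑ st ∈ Finset.HasAntidiagonal.antidiagonal i, (E (st.1 + 1, st.2) - E (st.1, st.2 + 1)) =
      perturbedStep x (x - freeCoeff) i := by
    refine Finset.sum_congr rfl fun st hst => ?_
    rw [Finset.HasAntidiagonal.mem_antidiagonal] at hst
    have h4 := sum_pathWeight_mul_ballot_sub x st.1 st.2 i
    rw [pathWeight_of_lt x (show st.1 < i + 1 by omega),
      ballot_of_lt (show st.2 < i + 1 by omega), zero_mul, mul_zero, sub_zero, add_zero,
      Finset.sum_sub_distrib] at h4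
    exact h4
  rw [Finset.sum_sub_distrib] at h3
  linarith

theorem perturbedStep_smul (x y : ℕ → ℝ) (c : ℝ) (i : ℕ) :
    perturbedStep x (c • y) i = c * perturbedStep x y i := by
  simp only [perturbedStep, Finset.mul_sum, Pi.smul_apply, smul_eq_mul]
  refine Finset.sum_congr rfl fun st _ => Finset.sum_congr rfl fun h _ => ?_
  ring

/-- The derivative of the moments at the semicircle law is D: summing over the position of the
perturbed step is the last-passage convolution. -/
theorem perturbedStep_freeCoeff (y : ℕ → ℝ) {i k : ℕ} (hik : i < k) :
    perturbedStep freeCoeff y i = ∑ j ∈ Finset.range k, ballot (i + 1) (j + 1) * y j := by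
  have hpair : ∀ (f : ℕ → ℝ) (n : ℕ), ∑ h ∈ Finset.range n, (f (2 * h) + f (2 * h + 1)) =
      ∑ j ∈ Finset.range (2 * n), f j := by
    intro f n
    induction n with
    | zero => norm_num
    | succ n ih =>
      rw [Finset.sum_range_succ, ih, show 2 * (n + 1) = 2 * n + 1 + 1 by ring,
        Finset.sum_range_succ, Finset.sum_range_succ]
      ring
  have hvanish : ∀ n, i < n → ∑ j ∈ Finset.range n, ballot (i + 1) (j + 1) * y j =
      ∑ j ∈ Finset.range (i + 1), ballot (i + 1) (j + 1) * y j := by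
    intro n hn
    symm
    refine Finset.sum_subset (fun a ha => ?_) fun a _ ha => ?_
    · rw [Finset.mem_range] at *
      omega
    · rw [Finset.mem_range] at ha
      rw [ballot_of_lt (by omega), zero_mul]
  -- Terms with j > i vanish, so the range may be resized to an even length, where level and down
  -- weights pair up.
  rw [hvanish k hik, ← hvanish (2 * (i + 1)) (by omega), ← hpair, perturbedStep, Finset.sum_comm]
  refine Finset.sum_congr rfl fun h _ => ?_
  have e1 := sum_antidiagonal_ballot_mul i h h
  have e2 := sum_antidiagonal_ballot_mul i (h + 1) h
  rw [show h + h + 1 = 2 * h + 1 by ring] at e1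
  rw [show h + 1 + h + 1 = 2 * h + 1 + 1 by ring] at e2
  rw [← e1, ← e2, Finset.sum_mul, Finset.sum_mul, ← Finset.sum_add_distrib]
  refine Finset.sum_congr rfl fun st _ => ?_
  simp only [ballot]
  ring

theorem continuous_perturbedStep {E : Type*} [TopologicalSpace E] {x y : E → ℕ → ℝ}
    (hx : Continuous x) (hy : Continuous y) (i : ℕ) :
    Continuous fun p => perturbedStep (x p) (y p) i := by
  unfold perturbedStep
  refine continuous_finsetSum _ fun st _ => continuous_finsetSum _ fun h _ => ?_
  have h1 := (continuous_pathWeight st.1 h).comp hx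
  have h2 := (continuous_pathWeight st.1 (h + 1)).comp hx
  simp only [Function.comp_def] at h1 h2
  fun_prop

/-! ### The moment map takes values in the interior of the moment space -/

/-- The Jacobi matrix with the recursion coefficients `x`. -/
def jacobiMatrix (n : ℕ) (x : ℕ → ℝ) : Matrix (Fin n) (Fin n) ℝ :=
  Matrix.of fun i l => (if (l : ℕ) = i then x (2 * i) else 0) +
    (if (l : ℕ) = i + 1 then √(x (2 * i + 1)) else 0) +
    (if (l : ℕ) + 1 = i then √(x (2 * l + 1)) else 0)

theorem isHermitian_jacobiMatrix (n : ℕ) (x : ℕ → ℝ) : (jacobiMatrix n x).IsHermitian := by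
  ext i l
  simp only [jacobiMatrix, Matrix.conjTranspose_apply, Matrix.of_apply, star_trivial]
  by_cases h : (l : ℕ) = i
  · simp [h]
  · rw [if_neg h, if_neg (Ne.symm h), zero_add, zero_add, add_comm]
    congr 1 <;> simp only [eq_comm]

/-- Rescaling height h by √(`downProd x h`) symmetrises the step operator. The vanishing of x (2n+1)
cuts the operator off at height n. -/
theorem jacobiMatrix_mulVec {n : ℕ} {x : ℕ → ℝ} (hx : ∀ h, 0 ≤ x (2 * h + 1))
    (hn : x (2 * n + 1) = 0) (j : ℕ) :
    (jacobiMatrix (n + 1) x) *ᵥ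
        (fun h : Fin (n + 1) => pathWeight x j h * √(downProd x h)) =
      fun h : Fin (n + 1) => pathWeight x (j + 1) h * √(downProd x h) := by
  have hA : ∀ h, 0 ≤ downProd x h := fun h => Finset.prod_nonneg fun l _ => hx l
  ext h
  have h1 : ∑ l ∈ Finset.range (n + 1), (if l = (h : ℕ) + 1 then √(x (2 * h + 1)) else 0) *
      (pathWeight x j l * √(downProd x l)) =
      x (2 * h + 1) * pathWeight x j (h + 1) * √(downProd x h) := by
    simp only [ite_mul, zero_mul, Finset.sum_ite_eq', Finset.mem_range]
    split_ifs with hh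
    · rw [downProd_succ, Real.sqrt_mul (hA _)]
      linear_combination (pathWeight x j (h + 1) * √(downProd x h)) * Real.mul_self_sqrt (hx h)
    · have : (h : ℕ) = n := by have := h.2; omega
      simp [this, hn]
  have h2 : ∀ k : ℕ, k < n + 1 → ∑ l ∈ Finset.range (n + 1),
      (if l + 1 = k then √(x (2 * l + 1)) else 0) * (pathWeight x j l * √(downProd x l)) =
      (if k = 0 then 0 else pathWeight x j (k - 1)) * √(downProd x k) := by
    intro k hk
    cases k with
    | zero => simp
    | succ k =>
      simp only [Nat.add_right_cancel_iff, ite_mul, zero_mul, Finset.sum_ite_eq', Finset.mem_range]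
      rw [if_pos (by omega), if_neg (by omega), downProd_succ, Real.sqrt_mul (hA _)]
      simp only [Nat.add_sub_cancel]
      ring
  have h3 : ∑ l ∈ Finset.range (n + 1), (if l = (h : ℕ) then x (2 * h) else 0) *
      (pathWeight x j l * √(downProd x l)) = x (2 * h) * pathWeight x j h * √(downProd x h) := by
    simp only [ite_mul, zero_mul, Finset.sum_ite_eq', Finset.mem_range, if_pos h.2]
    ring
  have h4 : ∀ k, pathWeight x (j + 1) k = (if k = 0 then 0 else pathWeight x j (k - 1)) +
      x (2 * k) * pathWeight x j k + x (2 * k + 1) * pathWeight x j (k + 1) := by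
    intro k
    cases k <;> simp [pathWeight]
  simp only [Matrix.mulVec, dotProduct, jacobiMatrix, Matrix.of_apply]
  rw [← Finset.sum_range fun l => ((if l = (h : ℕ) then x (2 * h) else 0) +
    (if l = (h : ℕ) + 1 then √(x (2 * h + 1)) else 0) +
    (if l + 1 = (h : ℕ) then √(x (2 * l + 1)) else 0)) * (pathWeight x j l * √(downProd x l))]
  simp only [add_mul, Finset.sum_add_distrib]
  rw [h1, h2 h h.2, h3, h4]
  ring

/-- Both sides are ⟨e_0, J^j e_0⟩ for the Jacobi matrix J, the left one written in an eigenbasis. -/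
theorem sum_sq_mul_eigenvalues_pow {n : ℕ} {x : ℕ → ℝ} (hx : ∀ h, 0 ≤ x (2 * h + 1))
    (hn : x (2 * n + 1) = 0) (j : ℕ) :
    ∑ i, ((isHermitian_jacobiMatrix (n + 1) x).eigenvectorBasis i 0) ^ 2 *
      (isHermitian_jacobiMatrix (n + 1) x).eigenvalues i ^ j = pathWeight x j 0 := by
  set hJ := isHermitian_jacobiMatrix (n + 1) x
  set v : ℕ → Fin (n + 1) → ℝ := fun j h => pathWeight x j h * √(downProd x h) with hv
  have hv0 : v 0 = Pi.single 0 1 := by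
    ext h
    by_cases hh : h = 0
    · subst hh
      simp [hv, pathWeight, downProd]
    · have : 0 < (h : ℕ) := Nat.pos_of_ne_zero fun h0 => hh (Fin.ext h0)
      simp [hv, hh, pathWeight_of_lt x this]
  have hstep : ∀ i j, (hJ.eigenvectorBasis i).ofLp ⬝ᵥ v j =
      hJ.eigenvalues i ^ j * hJ.eigenvectorBasis i 0 := by
    intro i j
    induction j with
    | zero => simp [hv0]
    | succ j ih =>
      have h1 : v (j + 1) = jacobiMatrix (n + 1) x *ᵥ v j := (jacobiMatrix_mulVec hx hn j).symm
      have h2 : (jacobiMatrix (n + 1) x)ᵀ = jacobiMatrix (n + 1) x := by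
        rw [← Matrix.conjTranspose_eq_transpose_of_trivial]; exact hJ
      rw [h1, Matrix.dotProduct_mulVec, ← Matrix.mulVec_transpose, h2,
        hJ.mulVec_eigenvectorBasis, smul_dotProduct, ih, smul_eq_mul, pow_succ]
      ring
  have hsum := hJ.eigenvectorBasis.sum_inner_mul_inner
    (EuclideanSpace.single (0 : Fin (n + 1)) (1 : ℝ)) (WithLp.toLp 2 (v j))
  have hr : ∀ i, inner ℝ (hJ.eigenvectorBasis i) (WithLp.toLp 2 (v j)) =
      hJ.eigenvalues i ^ j * hJ.eigenvectorBasis i 0 := by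
    intro i
    rw [← hstep i j, EuclideanSpace.inner_eq_star_dotProduct, star_trivial, dotProduct_comm]
  have hl : ∀ y : EuclideanSpace ℝ (Fin (n + 1)),
      inner ℝ (EuclideanSpace.single (0 : Fin (n + 1)) (1 : ℝ)) y = y 0 := by
    intro y
    simp [EuclideanSpace.inner_single_left]
  simp only [hr, hl] at hsum
  have hj : v j 0 = pathWeight x j 0 := by simp [hv, downProd]
  rw [← hj, ← hsum]
  exact Finset.sum_congr rfl fun i _ => by ring

/-- The representing measure is the spectral measure of the Jacobi matrix at e_0, with finitely many
atoms. -/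
theorem momentMap_mem_momentSpace {N n : ℕ} (hN : N = 2 * n + 1) {x : Fin N → ℝ}
    (hx : x ∈ positiveCoeffs N) : momentMap N x ∈ momentSpace N := by
  have hx0 : ∀ h, 0 ≤ zeroExtend x (2 * h + 1) := by
    intro h
    rcases lt_or_ge (2 * h + 1) N with hh | hh
    · rw [zeroExtend_of_lt x hh]
      exact (hx _ ⟨h, rfl⟩).le
    · rw [zeroExtend_of_le x hh]
  have key := sum_sq_mul_eigenvalues_pow hx0 (zeroExtend_of_le x hN.le)
  set hJ := isHermitian_jacobiMatrix (n + 1) (zeroExtend x)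
  set μ : Measure ℝ := ∑ i, ENNReal.ofReal ((hJ.eigenvectorBasis i 0) ^ 2) •
    Measure.dirac (hJ.eigenvalues i) with hμ
  have hint : ∀ j : ℕ, ∀ i, Integrable (fun y : ℝ => y ^ j)
      (ENNReal.ofReal ((hJ.eigenvectorBasis i 0) ^ 2) • Measure.dirac (hJ.eigenvalues i)) :=
    fun j i => (integrable_dirac (by simp)).smul_measure ENNReal.ofReal_ne_top
  refine ⟨μ, ⟨?_⟩, fun j => ?_, fun i => ?_⟩
  · have h0 := key 0
    simp only [pow_zero, mul_one] at h0
    rw [hμ, Measure.finsetSum_apply]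
    simp only [Measure.smul_apply, measure_univ, smul_eq_mul, mul_one]
    rw [← ENNReal.ofReal_sum_of_nonneg fun i _ => sq_nonneg _, h0]
    simp [pathWeight]
  · exact integrable_finsetSum_measure.2 fun i _ => hint j i
  · rw [hμ, integral_finsetSum_measure fun l _ => hint _ l]
    simp only [integral_smul_measure, integral_dirac, smul_eq_mul,
      ENNReal.toReal_ofReal (sq_nonneg _)]
    exact (key _).symm

/-! ### The derivative of the moment map -/

/-- Cutting the paths in the middle, only the summand of greatest height involves x i, and it does
so affinely. Hence the Jacobian is triangular with explicit diagonal. -/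
theorem pathWeight_sub_of_agree {x y : ℕ → ℝ} {i : ℕ} (hxy : ∀ l < i, x l = y l) :
    pathWeight x (i + 1) 0 - pathWeight y (i + 1) 0 = downProd y (i / 2) * (x i - y i) := by
  have hA : ∀ h, 2 * h ≤ i → downProd x h = downProd y h := fun h hh =>
    Finset.prod_congr rfl fun l hl => hxy _ (by rw [Finset.mem_range] at hl; omega)
  rcases Nat.even_or_odd' i with ⟨k, rfl | rfl⟩
  · have hs : ∀ z : ℕ → ℝ, pathWeight z (2 * k + 1) 0 = ∑ h ∈ Finset.range (k + 1),
        pathWeight z k h * downProd z h * pathWeight z (k + 1) h := by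
      intro z
      rw [show 2 * k + 1 = k + (k + 1) by ring]
      exact pathWeight_add_eq_sum z _ (by omega)
    rw [hs, hs, Finset.sum_range_succ, Finset.sum_range_succ]
    have e1 : ∑ h ∈ Finset.range k, pathWeight x k h * downProd x h * pathWeight x (k + 1) h =
        ∑ h ∈ Finset.range k, pathWeight y k h * downProd y h * pathWeight y (k + 1) h := by
      refine Finset.sum_congr rfl fun h hh => ?_
      rw [Finset.mem_range] at hh
      rw [hA h (by omega), pathWeight_congr (x := x) (y := y) fun i hi => hxy i (by omega),
        pathWeight_congr (x := x) (y := y) (j := k + 1) fun i hi => hxy i (by omega)]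
    have e2 : ∑ l ∈ Finset.range k, x (2 * l) = ∑ l ∈ Finset.range k, y (2 * l) :=
      Finset.sum_congr rfl fun l hl => hxy _ (by rw [Finset.mem_range] at hl; omega)
    rw [e1, pathWeight_self, pathWeight_self, pathWeight_succ_self, pathWeight_succ_self,
      Finset.sum_range_succ, Finset.sum_range_succ, e2, hA k le_rfl,
      show 2 * k / 2 = k by omega]
    ring
  · have hs : ∀ z : ℕ → ℝ, pathWeight z (2 * k + 1 + 1) 0 = ∑ h ∈ Finset.range (k + 2),
        pathWeight z (k + 1) h * downProd z h * pathWeight z (k + 1) h := by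
      intro z
      rw [show 2 * k + 1 + 1 = k + 1 + (k + 1) by ring]
      exact pathWeight_add_eq_sum z _ (by omega)
    rw [hs, hs, Finset.sum_range_succ _ (k + 1), Finset.sum_range_succ _ (k + 1)]
    have e1 : ∑ h ∈ Finset.range (k + 1),
          pathWeight x (k + 1) h * downProd x h * pathWeight x (k + 1) h =
        ∑ h ∈ Finset.range (k + 1),
          pathWeight y (k + 1) h * downProd y h * pathWeight y (k + 1) h := by
      refine Finset.sum_congr rfl fun h hh => ?_
      rw [Finset.mem_range] at hh
      rw [hA h (by omega),
        pathWeight_congr (x := x) (y := y) (j := k + 1) fun i hi => hxy i (by omega)]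
    rw [e1, pathWeight_self, pathWeight_self, downProd_succ, downProd_succ, hA k (by omega),
      show (2 * k + 1) / 2 = k by omega]
    ring

theorem contDiff_pathWeight_zeroExtend (N : ℕ) :
    ∀ j h : ℕ, ContDiff ℝ 1 fun x : Fin N → ℝ => pathWeight (zeroExtend x) j h := by
  have h0 : ∀ i, ContDiff ℝ 1 fun x : Fin N → ℝ => zeroExtend x i := by
    intro i
    rcases lt_or_ge i N with h | h
    · simpa only [zeroExtend_of_lt _ h] using contDiff_apply ℝ ℝ _
    · simpa only [zeroExtend_of_le _ h] using contDiff_const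
  intro j
  induction j with
  | zero => intro h; cases h <;> simpa [pathWeight] using contDiff_const
  | succ j ih =>
    intro h
    cases h with
    | zero =>
      simp only [pathWeight]
      exact ((h0 _).mul (ih _)).add ((h0 _).mul (ih _))
    | succ h =>
      simp only [pathWeight]
      exact ((ih _).add ((h0 _).mul (ih _))).add ((h0 _).mul (ih _))

theorem contDiff_momentMap (N : ℕ) : ContDiff ℝ 1 (momentMap N) :=
  contDiff_pi.2 fun i => contDiff_pathWeight_zeroExtend N (i + 1) 0

theorem det_fderiv_momentMap (N : ℕ) (x : Fin N → ℝ) :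
    (fderiv ℝ (momentMap N) x).det = ∏ i : Fin N, downProd (zeroExtend x) (i / 2) := by
  have hd : HasFDerivAt (momentMap N) (fderiv ℝ (momentMap N) x) x :=
    ((contDiff_momentMap N).differentiable one_ne_zero x).hasFDerivAt
  -- Moving a coordinate j ≥ i fixes all coordinates before i, so the moment is affine along this
  -- line.
  have hentry : ∀ i j : Fin N, i ≤ j → fderiv ℝ (momentMap N) x (Pi.single j 1) i =
      downProd (zeroExtend x) (i / 2) * if i = j then 1 else 0 := by
    intro i j hij
    have h1 := (hasDerivAt_pi.1 (hd.hasLineDerivAt (Pi.single j 1))) i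
    have h2 : HasDerivAt (fun t : ℝ => pathWeight (zeroExtend x) (i + 1) 0 +
        downProd (zeroExtend x) (i / 2) * (t * if i = j then 1 else 0))
        (downProd (zeroExtend x) (i / 2) * (1 * if i = j then 1 else 0)) 0 :=
      (((hasDerivAt_id (0 : ℝ)).mul_const _).const_mul _).const_add _
    rw [one_mul] at h2
    refine h1.unique (h2.congr_of_eventuallyEq (Eventually.of_forall fun t => ?_))
    have h3 := pathWeight_sub_of_agree (x := zeroExtend (x + t • Pi.single j 1))
      (y := zeroExtend x) (i := i) (fun l hl => by
        have hlj : l ≠ j := by have : (i : ℕ) ≤ j := hij; omega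
        rcases lt_or_ge l N with h | h
        · rw [zeroExtend_of_lt _ h, zeroExtend_of_lt _ h]
          simp [Fin.ext_iff, hlj]
        · rw [zeroExtend_of_le _ h, zeroExtend_of_le _ h])
    rw [zeroExtend_coe, zeroExtend_coe] at h3
    simp only [momentMap]
    rw [sub_eq_iff_eq_add'] at h3
    rw [h3]
    simp [Pi.single_apply]
  rw [ContinuousLinearMap.det, ← LinearMap.det_toMatrix', Matrix.det_of_isLowerTriangular]
  · refine Finset.prod_congr rfl fun i _ => ?_
    rw [LinearMap.toMatrix'_apply]
    simpa using hentry i i le_rfl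
  · intro i j hij
    have h1 : i < j := hij
    rw [LinearMap.toMatrix'_apply]
    simpa [h1.ne] using hentry i j h1.le

/-- The derivative is invertible, so the image of the open set `positiveCoeffs N` is a neighbourhood
of each of its points. -/
theorem momentMap_mem_interior {N n : ℕ} (hN : N = 2 * n + 1) {x : Fin N → ℝ}
    (hx : x ∈ positiveCoeffs N) : momentMap N x ∈ interior (momentSpace N) := by
  have hs : HasStrictFDerivAt (momentMap N) (fderiv ℝ (momentMap N) x) x :=
    (contDiff_momentMap N).contDiffAt.hasStrictFDerivAt one_ne_zero
  have hdet : (fderiv ℝ (momentMap N) x).det ≠ 0 := by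
    rw [det_fderiv_momentMap]
    exact Finset.prod_ne_zero_iff.2 fun i _ => (downProd_pos hx (by have := i.2; omega)).ne'
  have hsurj : (fderiv ℝ (momentMap N) x).range = ⊤ :=
    LinearMap.range_eq_top.2 (LinearMap.equivOfDetNeZero _ hdet).surjective
  rw [mem_interior_iff_mem_nhds, ← hs.map_nhds_eq_of_surj hsurj]
  exact mem_map.2 (mem_of_superset ((isOpen_positiveCoeffs N).mem_nhds hx) fun y hy =>
    momentMap_mem_momentSpace hN hy)

/-! ### Products of measures with densities -/

theorem lintegral_fin_prod_eq_prod {n : ℕ} {μ : Fin n → Measure ℝ} [∀ i, SigmaFinite (μ i)]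
    {f : Fin n → ℝ → ENNReal} (hf : ∀ i, Measurable (f i)) :
    ∫⁻ x, ∏ i, f i (x i) ∂(Measure.pi μ) = ∏ i, ∫⁻ y, f i y ∂(μ i) := by
  induction n with
  | zero => simp
  | succ n ih =>
    have hm := (measurePreserving_piFinSuccAbove μ 0).symm
    have hmeas : ∀ {k : ℕ} {g : Fin k → ℝ → ENNReal}, (∀ i, Measurable (g i)) →
        Measurable fun x : Fin k → ℝ => ∏ i, g i (x i) := fun hg =>
      Finset.measurable_fun_prod _ fun i _ => (hg i).comp (measurable_pi_apply i)
    rw [← hm.lintegral_comp (hmeas hf)]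
    simp only [Fin.prod_univ_succ, MeasurableEquiv.piFinSuccAbove_symm_apply,
      Fin.insertNthEquiv_zero, Fin.consEquiv_apply, Fin.cons_zero, Fin.cons_succ, Fin.succAbove_zero]
    rw [← ih fun i => hf i.succ]
    exact lintegral_prod_mul (hf 0).aemeasurable (hmeas fun i => hf i.succ).aemeasurable

theorem pi_withDensity {n : ℕ} {f : Fin n → ℝ → ENNReal} (hf : ∀ i, Measurable (f i))
    [∀ i, SigmaFinite (volume.withDensity (f i))] :
    Measure.pi (fun i => volume.withDensity (f i)) =
      (volume : Measure (Fin n → ℝ)).withDensity fun x => ∏ i, f i (x i) := by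
  refine Measure.pi_eq fun s hs => ?_
  rw [withDensity_apply _ (MeasurableSet.univ_pi hs), ← lintegral_indicator (.univ_pi hs)]
  simp only [withDensity_apply _ (hs _), ← lintegral_indicator (hs _)]
  rw [← lintegral_fin_prod_eq_prod fun i => (hf i).indicator (hs i), volume_pi]
  refine lintegral_congr fun x => ?_
  by_cases hx : x ∈ Set.univ.pi s
  · rw [Set.indicator_of_mem hx]
    exact Finset.prod_congr rfl fun i _ => (Set.indicator_of_mem (hx i trivial) _).symm
  · rw [Set.indicator_of_notMem hx]
    simp only [Set.mem_univ_pi, not_forall] at hx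
    obtain ⟨i, hi⟩ := hx
    exact (Finset.prod_eq_zero (Finset.mem_univ i) (Set.indicator_of_notMem hi _)).symm

/-! ### The law of the recursion coefficients -/

/-- The density of the `i`-th recursion coefficient: Gaussian for `b_{i / 2 + 1}`, `i` even, and
Gamma for `a_{i / 2 + 1}`, `i` odd. -/
def coeffPDFReal (γ : ℕ → ℝ) (n i : ℕ) : ℝ → ℝ :=
  if Even i then gaussianPDFReal 0 (2 * n)⁻¹
  else gammaPDFReal (γ (i / 2 + 1) + 2 * n - 2 * ((i / 2 + 1 : ℕ) : ℝ)) (2 * n)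

/-- The law of the `i`-th recursion coefficient. -/
def coeffLaw (γ : ℕ → ℝ) (n i : ℕ) : Measure ℝ :=
  volume.withDensity fun y => ENNReal.ofReal (coeffPDFReal γ n i y)

theorem coeffLaw_of_even (γ : ℕ → ℝ) {n i : ℕ} (hn : 1 ≤ n) (hi : Even i) :
    coeffLaw γ n i = gaussianReal 0 (2 * n)⁻¹ := by
  rw [gaussianReal_of_var_ne_zero _ (by positivity), coeffLaw, coeffPDFReal, if_pos hi]
  rfl

theorem coeffLaw_of_odd (γ : ℕ → ℝ) (n : ℕ) {i : ℕ} (hi : Odd i) :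
    coeffLaw γ n i =
      gammaMeasure (γ (i / 2 + 1) + 2 * n - 2 * ((i / 2 + 1 : ℕ) : ℝ)) (2 * n) := by
  rw [coeffLaw, coeffPDFReal, if_neg (Nat.not_even_iff_odd.2 hi)]
  rfl

/-- Since k ≤ n - 1, the shape exceeds -1 + 2. A shape above 1 makes the Gamma density vanish at 0
as well, so the product density is zero everywhere off `positiveCoeffs`. -/
theorem one_lt_shape {γ : ℕ → ℝ} (hγ : ∀ k, 1 ≤ k → -1 < γ k) {n i : ℕ} (hi : i < 2 * n - 1)
    (ho : Odd i) : 1 < γ (i / 2 + 1) + 2 * n - 2 * ((i / 2 + 1 : ℕ) : ℝ) := by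
  have h1 := hγ (i / 2 + 1) (by omega)
  have h2 : i / 2 + 1 + 1 ≤ n := by obtain ⟨l, rfl⟩ := ho; omega
  have h3 : (((i / 2 + 1 : ℕ) : ℝ) + 1) ≤ n := by exact_mod_cast h2
  linarith

theorem measurable_coeffPDFReal (γ : ℕ → ℝ) (n i : ℕ) : Measurable (coeffPDFReal γ n i) := by
  unfold coeffPDFReal
  split_ifs
  · exact measurable_gaussianPDFReal _ _
  · exact measurable_gammaPDFReal _ _

theorem coeffPDFReal_nonneg {γ : ℕ → ℝ} (hγ : ∀ k, 1 ≤ k → -1 < γ k) {n i : ℕ}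
    (hi : i < 2 * n - 1) (y : ℝ) : 0 ≤ coeffPDFReal γ n i y := by
  have hn : 0 < n := by omega
  unfold coeffPDFReal
  split_ifs with h
  · exact gaussianPDFReal_nonneg _ _ _
  · exact gammaPDFReal_nonneg
      (one_pos.trans (one_lt_shape hγ hi (Nat.not_even_iff_odd.1 h))) (by positivity) _

theorem coeffPDFReal_of_nonpos {γ : ℕ → ℝ} (hγ : ∀ k, 1 ≤ k → -1 < γ k) {n i : ℕ}
    (hi : i < 2 * n - 1) (ho : Odd i) {y : ℝ} (hy : y ≤ 0) : coeffPDFReal γ n i y = 0 := by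
  rw [coeffPDFReal, if_neg (Nat.not_even_iff_odd.2 ho), gammaPDFReal]
  split_ifs with h
  · have := one_lt_shape hγ hi ho
    rw [le_antisymm hy h, Real.zero_rpow (by linarith)]
    simp
  · rfl

theorem isProbabilityMeasure_coeffLaw {γ : ℕ → ℝ} (hγ : ∀ k, 1 ≤ k → -1 < γ k) {n i : ℕ}
    (hi : i < 2 * n - 1) : IsProbabilityMeasure (coeffLaw γ n i) := by
  have hn : 0 < n := by omega
  rcases Nat.even_or_odd i with h | h
  · rw [coeffLaw_of_even γ hn h]
    infer_instance
  · rw [coeffLaw_of_odd γ n h]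
    exact isProbabilityMeasure_gammaMeasure (one_pos.trans (one_lt_shape hγ hi h)) (by positivity)

/-! ### The law of the moments as an image of a product measure -/

/-- With n = p + 1 and k = l + 1 the exponent is 2n - 2k - 1, which raises a_k^γ_k to the power in
the Gamma density of shape γ_k + 2n - 2k. -/
theorem prod_downProd (x : ℕ → ℝ) (p : ℕ) :
    ∏ i ∈ Finset.range (2 * p + 1), downProd x (i / 2) =
      ∏ l ∈ Finset.range p, x (2 * l + 1) ^ (2 * (p - l) - 1) := by
  induction p with
  | zero => simp [downProd]
  | succ p ih =>
    rw [show 2 * (p + 1) + 1 = 2 * p + 1 + 1 + 1 by ring, Finset.prod_range_succ,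
      Finset.prod_range_succ, ih, Finset.prod_range_succ, show (2 * p + 1) / 2 = p by omega,
      show (2 * p + 1 + 1) / 2 = p + 1 by omega, downProd_succ]
    have h : ∏ l ∈ Finset.range p, x (2 * l + 1) ^ (2 * (p + 1 - l) - 1) =
        (∏ l ∈ Finset.range p, x (2 * l + 1) ^ (2 * (p - l) - 1)) * downProd x p ^ 2 := by
      rw [downProd, ← Finset.prod_pow, ← Finset.prod_mul_distrib]
      refine Finset.prod_congr rfl fun l hl => ?_
      rw [Finset.mem_range] at hl
      rw [← pow_add]
      congr 1
      omega
    rw [h, show 2 * (p + 1 - p) - 1 = 1 by omega, pow_one]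
    ring

theorem prod_range_two_mul_add_one {M : Type*} [CommMonoid M] (f : ℕ → M) (p : ℕ) :
    ∏ i ∈ Finset.range (2 * p + 1), f i =
      (∏ k ∈ Finset.range (p + 1), f (2 * k)) * ∏ k ∈ Finset.range p, f (2 * k + 1) := by
  induction p with
  | zero => simp
  | succ p ih =>
    rw [show 2 * (p + 1) + 1 = 2 * p + 1 + 1 + 1 by ring, Finset.prod_range_succ,
      Finset.prod_range_succ, ih, Finset.prod_range_succ _ (p + 1), Finset.prod_range_succ _ p,
      Finset.prod_range_succ (fun k => f (2 * k + 1)) p, show 2 * p + 1 + 1 = 2 * (p + 1) by ring]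
    simp only [mul_assoc, mul_comm, mul_left_comm]

theorem prod_Icc_one_eq_prod_range {M : Type*} [CommMonoid M] (f : ℕ → M) (p : ℕ) :
    ∏ k ∈ Finset.Icc 1 p, f k = ∏ k ∈ Finset.range p, f (k + 1) := by
  induction p with
  | zero => simp
  | succ p ih => rw [Finset.prod_Icc_succ_top (by omega), ih, Finset.prod_range_succ]

theorem prod_downProd_mul_density (γ : ℕ → ℝ) {n : ℕ} (hn : 1 ≤ n) {x : Fin (2 * n - 1) → ℝ}
    (hx : x ∈ positiveCoeffs (2 * n - 1)) :
    (∏ i : Fin (2 * n - 1), downProd (zeroExtend x) (i / 2)) *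
        density γ (fun j => if Odd j then (n : ℝ) else 2 * n) n (momentMap (2 * n - 1) x) =
      ∏ i : Fin (2 * n - 1), coeffPDFReal γ n i (x i) := by
  obtain ⟨p, rfl⟩ : ∃ p, n = p + 1 := ⟨n - 1, by omega⟩
  have hx0 : ∀ l, l < p → 0 < zeroExtend x (2 * l + 1) := fun l hl => by
    rw [zeroExtend_of_lt x (by omega : 2 * l + 1 < 2 * (p + 1) - 1)]
    exact hx _ ⟨l, rfl⟩
  have hN : 2 * (p + 1) - 1 = 2 * p + 1 := by omega
  have hR : ∏ i : Fin (2 * (p + 1) - 1), coeffPDFReal γ (p + 1) i (x i) =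
      ∏ i ∈ Finset.range (2 * p + 1), coeffPDFReal γ (p + 1) i (zeroExtend x i) := by
    rw [← hN, Finset.prod_range]
    simp
  have hL : ∏ i : Fin (2 * (p + 1) - 1), downProd (zeroExtend x) (i / 2) =
      ∏ l ∈ Finset.range p, zeroExtend x (2 * l + 1) ^ (2 * (p - l) - 1) := by
    rw [← prod_downProd, ← hN, Finset.prod_range]
  rw [density, if_pos (momentMap_mem_interior hN hx), hR, hL,
    prod_range_two_mul_add_one, Nat.add_sub_cancel, prod_Icc_one_eq_prod_range,
    prod_Icc_one_eq_prod_range, mul_left_comm, ← Finset.prod_mul_distrib]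
  congr 1
  · refine Finset.prod_congr rfl fun k hk => ?_
    rw [Finset.mem_range] at hk
    have h1 : Odd (2 * (k + 1) - 1) := ⟨k, by omega⟩
    simp only [if_pos h1]
    rw [recB_momentMap hx (by omega), coeffPDFReal, if_pos (even_two_mul k), gaussianPDFReal,
      ← Real.sqrt_inv]
    push_cast
    congr 2
    · field_simp
    · field_simp
      ring
  · refine Finset.prod_congr rfl fun l hl => ?_
    rw [Finset.mem_range] at hl
    have h1 : ¬ Odd (2 * (l + 1)) := by simp
    have h2 : ¬ Even (2 * l + 1) := by simp
    simp only [if_neg h1]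
    have hpos := hx0 l hl
    rw [recA_momentMap hx (by omega), coeffPDFReal, if_neg h2, gammaPDFReal, if_pos hpos.le,
      if_pos hpos, show (2 * l + 1) / 2 + 1 = l + 1 by omega]
    set y := zeroExtend x (2 * l + 1)
    have hexp : y ^ (γ (l + 1) + 2 * ((p + 1 : ℕ) : ℝ) - 2 * ((l + 1 : ℕ) : ℝ) - 1) =
        y ^ (2 * (p - l) - 1) * y ^ γ (l + 1) := by
      rw [← Real.rpow_natCast, ← Real.rpow_add hpos, Nat.cast_sub (by omega), Nat.cast_mul,
        Nat.cast_sub hl.le]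
      congr 1
      push_cast
      ring
    rw [hexp]
    push_cast
    ring_nf

/-- The change of variables is used only to bound the image measure by `momentLaw`; two probability
measures that are so ordered coincide. Thus surjectivity of the moment map onto the interior is
never needed. -/
theorem momentLaw_eq_map {γ : ℕ → ℝ} (hγ : ∀ k, 1 ≤ k → -1 < γ k) {n : ℕ} (hn : 1 ≤ n)
    [IsProbabilityMeasure (momentLaw γ (fun j => if Odd j then (n : ℝ) else 2 * n) n)] :
    momentLaw γ (fun j => if Odd j then (n : ℝ) else 2 * n) n =
      (Measure.pi fun i : Fin (2 * n - 1) => coeffLaw γ n i).map (momentMap (2 * n - 1)) := by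
  have hp : ∀ i : Fin (2 * n - 1), IsProbabilityMeasure (coeffLaw γ n i) :=
    fun i => isProbabilityMeasure_coeffLaw hγ i.2
  have hT : Measurable (momentMap (2 * n - 1)) := (contDiff_momentMap _).continuous.measurable
  have : IsProbabilityMeasure
      ((Measure.pi fun i : Fin (2 * n - 1) => coeffLaw γ n i).map (momentMap (2 * n - 1))) :=
    Measure.isProbabilityMeasure_map hT.aemeasurable
  symm
  refine Measure.eq_of_le_of_isProbabilityMeasure (Measure.le_iff.2 fun s hs => ?_)
  have hU : MeasurableSet (positiveCoeffs (2 * n - 1)) := (isOpen_positiveCoeffs _).measurableSet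
  have hA := hT hs
  have hpi : (Measure.pi fun i : Fin (2 * n - 1) => coeffLaw γ n i) =
      (volume : Measure (Fin (2 * n - 1) → ℝ)).withDensity
        fun x => ∏ i : Fin (2 * n - 1), ENNReal.ofReal (coeffPDFReal γ n i (x i)) :=
    pi_withDensity (f := fun (i : Fin (2 * n - 1)) y => ENNReal.ofReal (coeffPDFReal γ n i y))
      fun i => (measurable_coeffPDFReal γ n i).ennreal_ofReal
  rw [Measure.map_apply hT hs, hpi, withDensity_apply _ hA, momentLaw, withDensity_apply _ hs]
  have hind : (fun x : Fin (2 * n - 1) → ℝ =>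
      ∏ i : Fin (2 * n - 1), ENNReal.ofReal (coeffPDFReal γ n i (x i))) =
      (positiveCoeffs (2 * n - 1)).indicator fun x =>
        ENNReal.ofReal |(fderiv ℝ (momentMap (2 * n - 1)) x).det| * ENNReal.ofReal
          (density γ (fun j => if Odd j then (n : ℝ) else 2 * n) n (momentMap (2 * n - 1) x)) := by
    ext x
    by_cases hx : x ∈ positiveCoeffs (2 * n - 1)
    · rw [Set.indicator_of_mem hx, det_fderiv_momentMap, abs_of_nonneg, ← ENNReal.ofReal_mul,
        prod_downProd_mul_density γ hn hx, ENNReal.ofReal_prod_of_nonneg]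
      · exact fun i _ => coeffPDFReal_nonneg hγ i.2 _
      all_goals
        exact Finset.prod_nonneg fun i _ => (downProd_pos hx (by have := i.2; omega)).le
    · rw [Set.indicator_of_notMem hx]
      simp only [positiveCoeffs, Set.mem_ofPred_eq, not_forall, not_lt] at hx
      obtain ⟨i, hi, hxi⟩ := hx
      exact Finset.prod_eq_zero (Finset.mem_univ i) (by
        rw [coeffPDFReal_of_nonpos hγ i.2 hi hxi, ENNReal.ofReal_zero])
  rw [hind, lintegral_indicator hU, Measure.restrict_restrict hU,
    ← lintegral_image_eq_lintegral_abs_det_fderiv_mul volume (hU.inter hA)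
      (fun x _ => ((contDiff_momentMap _).differentiable one_ne_zero
        x).hasFDerivAt.hasFDerivWithinAt)
      ((injOn_momentMap _).mono Set.inter_subset_left)
      (fun m => ENNReal.ofReal (density γ (fun j => if Odd j then (n : ℝ) else 2 * n) n m))]
  -- The image of the preimage of s lies in s, which is all the inequality requires.
  refine lintegral_mono_set ?_
  rintro _ ⟨x, hx, rfl⟩
  exact hx.2

/-! ### The characteristic function of the Gamma distribution -/

/-- Exponential tilting by t turns the Gamma density of rate r into a multiple of the one of rate r
- t. -/
theorem lintegral_exp_mul_gammaMeasure {a r t : ℝ} (ha : 0 < a) (hr : 0 < r) (ht : t < r) :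
    ∫⁻ y, ENNReal.ofReal (Real.exp (t * y)) ∂(gammaMeasure a r) =
      ENNReal.ofReal (Real.exp (-a * Real.log (1 - t / r))) := by
  have h1 : 0 < r - t := sub_pos.2 ht
  have h2 : Real.exp (-a * Real.log (1 - t / r)) = r ^ a / (r - t) ^ a := by
    rw [← Real.div_rpow hr.le h1.le, Real.rpow_def_of_pos (div_pos hr h1),
      show 1 - t / r = (r / (r - t))⁻¹ by field_simp, Real.log_inv]
    congr 1
    ring
  have h3 : ∀ y, (gammaPDF a r * fun y => ENNReal.ofReal (Real.exp (t * y))) y =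
      ENNReal.ofReal (Real.exp (-a * Real.log (1 - t / r))) * gammaPDF a (r - t) y := by
    intro y
    rw [Pi.mul_apply, gammaPDF, gammaPDF, ← ENNReal.ofReal_mul' (Real.exp_pos _).le,
      ← ENNReal.ofReal_mul (Real.exp_pos _).le, h2]
    congr 1
    unfold gammaPDFReal
    split_ifs
    · have h4 : 0 < (r - t) ^ a := Real.rpow_pos_of_pos h1 a
      rw [show -((r - t) * y) = -(r * y) + t * y by ring, Real.exp_add]
      field_simp
    · simp
  have hm : ∀ s, Measurable (gammaPDF a s) := fun s => (measurable_gammaPDFReal a s).ennreal_ofReal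
  rw [gammaMeasure, lintegral_withDensity_eq_lintegral_mul _ (hm r) (by fun_prop),
    lintegral_congr h3, lintegral_const_mul _ (hm (r - t)),
    lintegral_gammaPDF_eq_one ha h1, mul_one]

/-- Both sides are values at it of functions analytic on Re z < r that agree at real points near 0,
so the identity theorem applies. -/
theorem charFun_gammaMeasure {a r : ℝ} (ha : 0 < a) (hr : 0 < r) (t : ℝ) :
    charFun (gammaMeasure a r) t =
      Complex.exp (-a * Complex.log (1 - t * Complex.I / r)) := by
  have hint : ∀ u < r, Integrable (fun y => Real.exp (u * y)) (gammaMeasure a r) := by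
    intro u hu
    rw [← lintegral_ofReal_ne_top_iff_integrable (by fun_prop)
      (Eventually.of_forall fun _ => (Real.exp_pos _).le), lintegral_exp_mul_gammaMeasure ha hr hu]
    exact ENNReal.ofReal_ne_top
  have hmgf : ∀ u < r, mgf id (gammaMeasure a r) u = Real.exp (-a * Real.log (1 - u / r)) := by
    intro u hu
    simp only [mgf, id]
    rw [integral_eq_lintegral_of_nonneg_ae (Eventually.of_forall fun _ => (Real.exp_pos _).le)
      (by fun_prop), lintegral_exp_mul_gammaMeasure ha hr hu,
      ENNReal.toReal_ofReal (Real.exp_pos _).le]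
  have hsub : Set.Iio r ⊆ interior (integrableExpSet id (gammaMeasure a r)) :=
    interior_maximal (fun u hu => hint u hu) isOpen_Iio
  set S : Set ℂ := {z | z.re < r} with hS
  have hf : AnalyticOnNhd ℂ (complexMGF id (gammaMeasure a r)) S :=
    fun z hz => analyticAt_complexMGF (hsub hz)
  have hg : AnalyticOnNhd ℂ (fun z : ℂ => Complex.exp (-a * Complex.log (1 - z / r))) S := by
    intro z hz
    have hz' : 1 - z / r ∈ Complex.slitPlane := by
      left
      rw [Complex.sub_re, Complex.one_re, Complex.div_ofReal_re, sub_pos, div_lt_one hr]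
      exact hz
    fun_prop (disch := exact hz')
  have hconn : IsPreconnected S := (convex_halfSpace_re_lt r).isPreconnected
  have hfreq : ∃ᶠ z in 𝓝[≠] ((0 : ℝ) : ℂ), complexMGF id (gammaMeasure a r) z =
      Complex.exp (-a * Complex.log (1 - z / r)) := by
    have hreal : ∃ᶠ u : ℝ in 𝓝[≠] (0 : ℝ), complexMGF id (gammaMeasure a r) u =
        Complex.exp (-a * Complex.log (1 - u / r)) := by
      refine Eventually.frequently ?_
      filter_upwards [mem_nhdsWithin_of_mem_nhds (Iio_mem_nhds hr)] with u hu
      rw [complexMGF_ofReal, hmgf u hu]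
      have : 0 ≤ 1 - u / r := by
        rw [sub_nonneg, div_le_one hr]
        exact le_of_lt hu
      push_cast [Complex.ofReal_log this]
      rfl
    refine Tendsto.frequently ?_ hreal
    rw [tendsto_nhdsWithin_iff]
    refine ⟨(Complex.continuous_ofReal.tendsto 0).mono_left nhdsWithin_le_nhds, ?_⟩
    filter_upwards [self_mem_nhdsWithin] with u hu
    simpa using hu
  rw [← complexMGF_id_mul_I]
  exact hf.eqOn_of_preconnected_of_frequently_eq hg hconn (z₀ := ((0 : ℝ) : ℂ))
    (by simpa [hS] using hr) hfreq (by simpa [hS] using hr)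

/-! ### Convergence of the normalized coefficients -/

/-- With w = -it/√(2n) the exponent is -(c + 2n) log(1 + w) + 2nw. The centring cancels the linear
term, 2nw² = -t² gives the limit, and both the Taylor remainder times 2n and the c-term tend to 0.
-/
theorem tendsto_charFun_gammaMeasure (c t : ℝ) :
    Tendsto (fun n : ℕ => charFun (gammaMeasure (c + 2 * n) (2 * n)) (√(2 * n) * t) *
      Complex.exp (-(√(2 * n) * t) * Complex.I)) atTop (𝓝 (Complex.exp (-(t ^ 2) / 2))) := by
  set w : ℕ → ℂ := fun n => -(t * Complex.I / √(2 * n)) with hw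
  have hN : Tendsto (fun n : ℕ => (2 * n : ℝ)) atTop atTop :=
    tendsto_natCast_atTop_atTop.const_mul_atTop two_pos
  have hsq : ∀ᶠ n : ℕ in atTop, (0 : ℝ) < √(2 * n) := by
    filter_upwards [eventually_gt_atTop 0] with n hn
    positivity
  have hnw : Tendsto (fun n => ‖w n‖) atTop (𝓝 0) := by
    have h1 : Tendsto (fun n : ℕ => |t| / √(2 * n)) atTop (𝓝 0) :=
      tendsto_const_nhds.div_atTop (Real.tendsto_sqrt_atTop.comp hN)
    refine h1.congr fun n => ?_
    simp [hw, abs_of_nonneg (Real.sqrt_nonneg _)]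
  have hw0 : Tendsto w atTop (𝓝 0) := tendsto_zero_iff_norm_tendsto_zero.2 hnw
  have hNw : ∀ᶠ n : ℕ in atTop, (2 * n : ℂ) * w n ^ 2 = -(t : ℂ) ^ 2 := by
    filter_upwards [hsq] with n hn
    have h1 : ((√(2 * n) : ℝ) : ℂ) ^ 2 = 2 * n := by
      rw [← Complex.ofReal_pow, Real.sq_sqrt (by positivity)]
      push_cast
      rfl
    have h2 : ((√(2 * n) : ℝ) : ℂ) ≠ 0 := by exact_mod_cast hn.ne'
    simp only [hw]
    rw [← h1]
    field_simp
    rw [Complex.I_sq]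
    ring
  have hrem : Tendsto (fun n : ℕ => (2 * n : ℂ) * (Complex.log (1 + w n) - (w n - w n ^ 2 / 2)))
      atTop (𝓝 0) := by
    rw [tendsto_zero_iff_norm_tendsto_zero]
    have hb : Tendsto (fun n => t ^ 2 * (‖w n‖ * (1 - ‖w n‖)⁻¹ / 3)) atTop (𝓝 0) := by
      have h1 : Tendsto (fun n => (1 - ‖w n‖)⁻¹) atTop (𝓝 (1 - 0)⁻¹) :=
        (tendsto_const_nhds.sub hnw).inv₀ (by norm_num)
      simpa using ((hnw.mul h1).div_const 3).const_mul (t ^ 2)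
    refine squeeze_zero' (Eventually.of_forall fun n => norm_nonneg _) ?_ hb
    filter_upwards [hNw, hnw.eventually_lt_const one_pos] with n h1 h2
    have h3 := Complex.norm_log_sub_logTaylor_le 2 h2
    have h4 : Complex.logTaylor (2 + 1) (w n) = w n - w n ^ 2 / 2 := by
      simp [Complex.logTaylor_succ, Complex.logTaylor_zero]
      ring
    rw [h4] at h3
    have h5 : ‖(2 * n : ℂ)‖ * ‖w n‖ ^ 2 = t ^ 2 := by
      rw [← norm_pow, ← norm_mul, h1, norm_neg, norm_pow, Complex.norm_real, Real.norm_eq_abs,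
        sq_abs]
    rw [norm_mul]
    calc _ ≤ ‖(2 * n : ℂ)‖ * (‖w n‖ ^ (2 + 1) * (1 - ‖w n‖)⁻¹ / ((2 : ℕ) + 1)) := by gcongr
      _ = ‖(2 * n : ℂ)‖ * ‖w n‖ ^ 2 * (‖w n‖ * (1 - ‖w n‖)⁻¹ / 3) := by push_cast; ring
      _ = _ := by rw [h5]
  have hlog : Tendsto (fun n => (c : ℂ) * Complex.log (1 + w n)) atTop (𝓝 0) := by
    have h1 : Tendsto (fun n => Complex.log (1 + w n)) atTop (𝓝 (Complex.log (1 + 0))) :=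
      (tendsto_const_nhds.add hw0).clog (by simp)
    simpa using h1.const_mul (c : ℂ)
  have hlim : Tendsto (fun n : ℕ => Complex.exp (-(t ^ 2) / 2 -
      (2 * n : ℂ) * (Complex.log (1 + w n) - (w n - w n ^ 2 / 2)) -
      (c : ℂ) * Complex.log (1 + w n))) atTop (𝓝 (Complex.exp (-(t ^ 2) / 2))) := by
    have h1 := (tendsto_const_nhds (x := -(t : ℂ) ^ 2 / 2)).sub hrem |>.sub hlog
    rw [sub_zero, sub_zero] at h1
    exact h1.cexp
  refine hlim.congr' ?_
  filter_upwards [hsq, hNw, hN.eventually_gt_atTop (-c), eventually_gt_atTop 0]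
    with n hn h1 h2 hn0
  rw [charFun_gammaMeasure (by linarith) (by positivity), ← Complex.exp_add]
  have h3 : ((√(2 * n) : ℝ) : ℂ) ≠ 0 := by exact_mod_cast hn.ne'
  have h4 : ((√(2 * n) : ℝ) : ℂ) ^ 2 = 2 * n := by
    rw [← Complex.ofReal_pow, Real.sq_sqrt (by positivity)]
    push_cast
    rfl
  have h5 : 1 - ((√(2 * n) * t : ℝ) : ℂ) * Complex.I / ((2 * n : ℝ) : ℂ) = 1 + w n := by
    simp only [hw]
    push_cast
    rw [← h4]
    field_simp
    ring
  have h6 : (2 * n : ℂ) * w n = -(√(2 * n) * t) * Complex.I := by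
    simp only [hw]
    rw [← h4]
    field_simp
  rw [h5, ← h6]
  congr 1
  push_cast
  linear_combination (-1 / 2 : ℂ) * h1

/-! ### Moments of the semicircle law -/

theorem integral_pow_semicircle (j : ℕ) :
    ∫ x, x ^ j ∂semicircle =
      1 / (2 * Real.pi) * ∫ x in (-2 : ℝ)..2, x ^ j * √(4 - x ^ 2) := by
  have hnn : ∀ x : ℝ, 0 ≤ (Set.Ioo (-2 : ℝ) 2).indicator
      (fun x => 1 / (2 * Real.pi) * √(4 - x ^ 2)) x := fun x =>
    Set.indicator_nonneg (fun y _ => by positivity) x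
  have hm : Measurable ((Set.Ioo (-2 : ℝ) 2).indicator
      (fun x => 1 / (2 * Real.pi) * √(4 - x ^ 2))) :=
    Measurable.indicator (by fun_prop) measurableSet_Ioo
  rw [semicircle, integral_withDensity_eq_integral_toReal_smul hm.ennreal_ofReal (by simp),
    intervalIntegral.integral_of_le (by norm_num), integral_Ioc_eq_integral_Ioo,
    ← integral_const_mul, ← integral_indicator measurableSet_Ioo]
  refine integral_congr_ae (Eventually.of_forall fun x => ?_)
  simp only [ENNReal.toReal_ofReal (hnn x), smul_eq_mul]
  by_cases hx : x ∈ Set.Ioo (-2 : ℝ) 2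
  · rw [Set.indicator_of_mem hx, Set.indicator_of_mem hx]
    ring
  · rw [Set.indicator_of_notMem hx, Set.indicator_of_notMem hx, zero_mul]

theorem integral_sqrt_four_sub_sq : ∫ x in (-2 : ℝ)..2, √(4 - x ^ 2) = 2 * Real.pi := by
  have h := intervalIntegral.integral_comp_mul_left (a := -1) (b := 1)
    (fun x : ℝ => √(4 - x ^ 2)) (c := 2) two_ne_zero
  have h2 : ∀ x : ℝ, √(4 - (2 * x) ^ 2) = 2 * √(1 - x ^ 2) := by
    intro x
    rw [show 4 - (2 * x) ^ 2 = 2 ^ 2 * (1 - x ^ 2) by ring, Real.sqrt_mul (by norm_num),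
      Real.sqrt_sq (by norm_num)]
  simp only [h2, intervalIntegral.integral_const_mul, integral_sqrt_one_sub_sq, smul_eq_mul] at h
  norm_num at h
  linarith

theorem integral_pow_mul_sqrt_of_odd {j : ℕ} (hj : Odd j) :
    ∫ x in (-2 : ℝ)..2, x ^ j * √(4 - x ^ 2) = 0 := by
  have h := intervalIntegral.integral_comp_neg (a := -2) (b := 2)
    (fun x : ℝ => x ^ j * √(4 - x ^ 2))
  simp only [hj.neg_pow, even_two.neg_pow, neg_mul, intervalIntegral.integral_neg, neg_neg] at h
  linarith

theorem integral_pow_add_two_mul_sqrt (j : ℕ) :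
    (j + 4) * ∫ x in (-2 : ℝ)..2, x ^ (j + 2) * √(4 - x ^ 2) =
      4 * (j + 1) * ∫ x in (-2 : ℝ)..2, x ^ j * √(4 - x ^ 2) := by
  have hint : ∀ i : ℕ, IntervalIntegrable (fun x : ℝ => x ^ i * √(4 - x ^ 2)) volume (-2) 2 :=
    fun i => Continuous.intervalIntegrable (by fun_prop) _ _
  -- The primitive is x^(j+1) (4 - x²)^(3/2), which vanishes at ±2.
  have hF : ∀ x ∈ Set.Ioo (-2 : ℝ) 2, HasDerivAt
      (fun x : ℝ => x ^ (j + 1) * ((4 - x ^ 2) * √(4 - x ^ 2)))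
      (4 * (j + 1) * (x ^ j * √(4 - x ^ 2)) - (j + 4) * (x ^ (j + 2) * √(4 - x ^ 2))) x := by
    intro x hx
    have hpos : 0 < 4 - x ^ 2 := by nlinarith [hx.1, hx.2]
    have h1 : HasDerivAt (fun x : ℝ => 4 - x ^ 2) (-(2 * x)) x := by
      simpa using (hasDerivAt_pow 2 x).const_sub 4
    have h2 := (hasDerivAt_pow (j + 1) x).mul (h1.mul (h1.sqrt hpos.ne'))
    refine h2.congr_deriv ?_
    have hs : √(4 - x ^ 2) ≠ 0 := (Real.sqrt_pos.2 hpos).ne'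
    have hsq := Real.sq_sqrt hpos.le
    simp only [Nat.add_sub_cancel, Pi.mul_apply]
    push_cast
    field_simp
    rw [hsq]
    ring
  have h := intervalIntegral.integral_eq_sub_of_hasDerivAt_of_le (by norm_num : (-2 : ℝ) ≤ 2)
    (by fun_prop) hF (((hint j).const_mul _).sub ((hint (j + 2)).const_mul _))
  rw [intervalIntegral.integral_sub ((hint j).const_mul _) ((hint (j + 2)).const_mul _),
    intervalIntegral.integral_const_mul, intervalIntegral.integral_const_mul] at h
  norm_num at h
  linarith

theorem integral_pow_two_mul_semicircle (m : ℕ) :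
    ∫ x, x ^ (2 * m) ∂semicircle = 1 / (m + 1 : ℝ) * ((2 * m).choose m : ℝ) := by
  rw [integral_pow_semicircle]
  induction m with
  | zero =>
    simp only [mul_zero, pow_zero, one_mul, integral_sqrt_four_sub_sq]
    simp
    field_simp
  | succ m ih =>
    have h1 := integral_pow_add_two_mul_sqrt (2 * m)
    have h2 := Nat.succ_mul_centralBinom_succ m
    simp only [Nat.centralBinom] at h2
    have h3 : ((m : ℝ) + 1) * ((2 * (m + 1)).choose (m + 1) : ℝ) =
        2 * (2 * m + 1) * ((2 * m).choose m : ℝ) := by exact_mod_cast h2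
    rw [show 2 * (m + 1) = 2 * m + 2 by ring] at h3 ⊢
    push_cast at h1 h3 ⊢
    have hm1 : (m : ℝ) + 1 ≠ 0 := by positivity
    have hm2 : (m : ℝ) + 1 + 1 ≠ 0 := by positivity
    field_simp at ih ⊢
    refine mul_left_cancel₀ (mul_ne_zero two_ne_zero hm1) ?_
    linear_combination (m + 1 : ℝ) * h1 + 4 * (2 * m + 1 : ℝ) * ih - 4 * Real.pi * h3

theorem integral_pow_semicircle_eq_ballot (j : ℕ) : ∫ x, x ^ j ∂semicircle = ballot j 0 := by
  rcases Nat.even_or_odd' j with ⟨m, rfl | rfl⟩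
  · rw [integral_pow_two_mul_semicircle, ballot_eq_choose_sub_choose m (by ring)]
    cases m with
    | zero => simp
    | succ m =>
      have h1 := Nat.choose_succ_right_eq (2 * (m + 1)) m
      rw [show 2 * (m + 1) - m = m + 2 by omega] at h1
      have h2 : ((2 * (m + 1)).choose (m + 1) : ℝ) * (m + 1) =
          ((2 * (m + 1)).choose m : ℝ) * (m + 2) := by exact_mod_cast h1
      rw [if_neg (by omega), Nat.add_sub_cancel]
      push_cast
      have hm2 : (m : ℝ) + 1 + 1 ≠ 0 := by positivity
      field_simp
      linear_combination -h2
  · rw [integral_pow_semicircle, integral_pow_mul_sqrt_of_odd ⟨m, rfl⟩, mul_zero,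
      ballot_of_odd (j := 0) ⟨m, rfl⟩]

/-! ### Convergence in distribution -/

/-- The normalization of the `i`-th recursion coefficient. -/
def normalize (n i : ℕ) (y : ℝ) : ℝ := √(2 * n) * (y - freeCoeff i)

theorem measurable_normalize (n i : ℕ) : Measurable (normalize n i) := by
  unfold normalize
  fun_prop

/-- For even i the normalised law is exactly standard normal when n ≥ 1; for odd i this is the Gamma
limit with c = γ_k - 2k, k = i/2 + 1. -/
theorem tendsto_charFun_normalize (γ : ℕ → ℝ) (i : ℕ) (t : ℝ) :
    Tendsto (fun n : ℕ => charFun ((coeffLaw γ n i).map (normalize n i)) t) atTop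
      (𝓝 (charFun (gaussianReal 0 1) t)) := by
  have hmap : ∀ (μ : Measure ℝ) (n : ℕ), charFun (μ.map (normalize n i)) t =
      charFun μ (√(2 * n) * t) * Complex.exp (-(√(2 * n) * t) * freeCoeff i * Complex.I) := by
    intro μ n
    have h1 : normalize n i = (fun y => y + -(√(2 * n) * freeCoeff i)) ∘ fun y => √(2 * n) * y := by
      ext y
      simp only [normalize, Function.comp_apply]
      ring
    rw [h1, ← Measure.map_map (by fun_prop) (by fun_prop), charFun_map_add_const, charFun_map_mul]
    congr 2
    simp
    ring
  have hg : charFun (gaussianReal 0 1) t = Complex.exp (-(t ^ 2) / 2) := by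
    rw [charFun_gaussianReal]
    congr 1
    push_cast
    ring
  simp only [hmap, hg]
  rcases Nat.even_or_odd i with hi | hi
  · refine tendsto_const_nhds.congr' ?_
    filter_upwards [eventually_ge_atTop 1] with n hn
    rw [coeffLaw_of_even γ hn hi, charFun_gaussianReal, freeCoeff, if_pos hi]
    have h4 : ((√(2 * n) : ℝ) : ℂ) ^ 2 = 2 * n := by
      rw [← Complex.ofReal_pow, Real.sq_sqrt (by positivity)]
      push_cast
      rfl
    have hn0 : (n : ℂ) ≠ 0 := by
      rw [Nat.cast_ne_zero]
      omega
    push_cast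
    rw [mul_pow, h4]
    simp only [mul_zero, zero_mul, Complex.exp_zero, mul_one]
    congr 1
    field_simp
    ring
  · have h := tendsto_charFun_gammaMeasure (γ (i / 2 + 1) - 2 * ((i / 2 + 1 : ℕ) : ℝ)) t
    refine h.congr fun n => ?_
    rw [coeffLaw_of_odd γ n hi, freeCoeff, if_neg (Nat.not_even_iff_odd.2 hi),
      sub_add_eq_add_sub, Complex.ofReal_one, mul_one]

/-- The vector of the first `k` normalized recursion coefficients. -/
def normalizedVector (k n : ℕ) {N : ℕ} (x : Fin N → ℝ) : EuclideanSpace ℝ (Fin k) :=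
  WithLp.toLp 2 fun i => normalize n i (zeroExtend x i)

theorem measurable_normalizedVector (k n N : ℕ) :
    Measurable (normalizedVector k n : (Fin N → ℝ) → EuclideanSpace ℝ (Fin k)) := by
  refine (WithLp.measurable_toLp 2 _).comp (measurable_pi_lambda _ fun i => ?_)
  exact (measurable_normalize n i).comp
    ((continuous_apply (i : ℕ)).comp continuous_zeroExtend).measurable

theorem map_normalizedVector {γ : ℕ → ℝ} (hγ : ∀ k, 1 ≤ k → -1 < γ k) {k n : ℕ}
    (hk : k ≤ 2 * n - 1) :
    (Measure.pi fun i : Fin (2 * n - 1) => coeffLaw γ n i).map (normalizedVector k n) =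
      (Measure.pi fun i : Fin k => (coeffLaw γ n i).map (normalize n i)).map (WithLp.toLp 2) := by
  have hp : ∀ i : Fin (2 * n - 1), IsProbabilityMeasure (coeffLaw γ n i) :=
    fun i => isProbabilityMeasure_coeffLaw hγ i.2
  have hm : ∀ i : Fin k, Measurable fun x : Fin (2 * n - 1) → ℝ =>
      normalize n i (x (Fin.castLE hk i)) :=
    fun i => (measurable_normalize n i).comp (measurable_pi_apply _)
  have hind : iIndepFun (fun (i : Fin k) (x : Fin (2 * n - 1) → ℝ) =>
      normalize n i (x (Fin.castLE hk i))) (Measure.pi fun i : Fin (2 * n - 1) => coeffLaw γ n i) :=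
    (iIndepFun_pi (X := fun (i : Fin (2 * n - 1)) (y : ℝ) => normalize n i y)
      fun i => (measurable_normalize n i).aemeasurable).precomp (Fin.castLE_injective hk)
  have hlaw := hind.map_fun_eq_pi_map fun i => (hm i).aemeasurable
  have hmarg : ∀ i : Fin k, (Measure.pi fun i : Fin (2 * n - 1) => coeffLaw γ n i).map
      (fun x => normalize n i (x (Fin.castLE hk i))) = (coeffLaw γ n i).map (normalize n i) := by
    intro i
    have h1 := (measurePreserving_eval (fun i : Fin (2 * n - 1) => coeffLaw γ n i)
      (Fin.castLE hk i)).map_eq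
    rw [Fin.val_castLE] at h1
    rw [← h1, Measure.map_map (measurable_normalize n i) (measurable_pi_apply _)]
    rfl
  simp only [hmarg] at hlaw
  rw [← hlaw, Measure.map_map (WithLp.measurable_toLp 2 _) (measurable_pi_lambda _ hm)]
  congr 1
  ext x i
  simp only [normalizedVector, Function.comp_apply]
  rw [zeroExtend_of_lt x (lt_of_lt_of_le i.2 hk)]
  rfl

/-- The second variable stands for 1/√(2n). Joint continuity at 0 replaces a bound on the nonlinear
terms. -/
theorem continuous_remainder (k : ℕ) :
    Continuous fun p : EuclideanSpace ℝ (Fin k) × ℝ => (WithLp.toLp 2 ((matD k)⁻¹ *ᵥ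
      fun i : Fin k => perturbedStep (freeCoeff + p.2 • zeroExtend p.1.ofLp)
        (zeroExtend p.1.ofLp) i) : EuclideanSpace ℝ (Fin k)) := by
  have h1 : Continuous fun p : EuclideanSpace ℝ (Fin k) × ℝ => zeroExtend p.1.ofLp :=
    continuous_zeroExtend.comp ((PiLp.continuous_ofLp 2 _).comp continuous_fst)
  have h2 : Continuous fun p : EuclideanSpace ℝ (Fin k) × ℝ =>
      freeCoeff + p.2 • zeroExtend p.1.ofLp :=
    Continuous.add continuous_const (Continuous.smul continuous_snd h1)
  have h3 : Continuous fun p : EuclideanSpace ℝ (Fin k) × ℝ => fun i : Fin k =>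
      perturbedStep (freeCoeff + p.2 • zeroExtend p.1.ofLp) (zeroExtend p.1.ofLp) i :=
    continuous_pi fun i => continuous_perturbedStep h2 h1 i
  have h4 : Continuous fun p : EuclideanSpace ℝ (Fin k) × ℝ => (matD k)⁻¹ *ᵥ fun i : Fin k =>
      perturbedStep (freeCoeff + p.2 • zeroExtend p.1.ofLp) (zeroExtend p.1.ofLp) i :=
    Continuous.matrix_mulVec continuous_const h3
  exact (PiLp.continuous_toLp 2 _).comp h4

theorem inv_matD_mulVec_perturbedStep_freeCoeff {k : ℕ} (z : Fin k → ℝ) :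
    (matD k)⁻¹ *ᵥ (fun i : Fin k => perturbedStep freeCoeff (zeroExtend z) i) = z := by
  have h : (fun i : Fin k => perturbedStep freeCoeff (zeroExtend z) i) = matD k *ᵥ z := by
    ext i
    rw [perturbedStep_freeCoeff _ i.2, Finset.sum_range]
    simp [Matrix.mulVec, dotProduct, matD, entryD_eq_ballot]
  rw [h, Matrix.mulVec_mulVec, Matrix.nonsing_inv_mul _ (by simp [det_matD]), Matrix.one_mulVec]

/-- Duhamel's formula at x = free + z/√(2n): `perturbedStep` is homogeneous in the perturbation, so
the factor √(2n) cancels. -/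
theorem normalized_proj_momentMap {k n : ℕ} (hn : 1 ≤ n) (hk : k ≤ 2 * n - 1)
    (x : Fin (2 * n - 1) → ℝ) :
    √(2 * n) • ((matD k)⁻¹ *ᵥ (proj k (momentMap (2 * n - 1) x) - semicircleMoments k)) =
      (matD k)⁻¹ *ᵥ fun i : Fin k =>
        perturbedStep (freeCoeff + (√(2 * n))⁻¹ • zeroExtend (normalizedVector k n x).ofLp)
          (zeroExtend (normalizedVector k n x).ofLp) i := by
  have hs : √(2 * n : ℝ) ≠ 0 := by positivity
  rw [← Matrix.mulVec_smul]
  congr 1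
  ext i
  set z := zeroExtend (normalizedVector k n x).ofLp with hz
  have hagree : ∀ l, l < (i : ℕ) + 1 + 0 → zeroExtend x l = (freeCoeff + (√(2 * n))⁻¹ • z) l := by
    intro l hl
    have hlk : l < k := by have := i.2; omega
    rw [Pi.add_apply, Pi.smul_apply, hz, zeroExtend_of_lt _ hlk]
    simp only [normalizedVector, normalize, smul_eq_mul]
    field_simp
    ring
  have h1 : (proj k (momentMap (2 * n - 1) x) - semicircleMoments k) i =
      pathWeight (freeCoeff + (√(2 * n))⁻¹ • z) (i + 1) 0 - ballot (i + 1) 0 := by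
    rw [← pathWeight_congr hagree, Pi.sub_apply, semicircleMoments,
      integral_pow_semicircle_eq_ballot, proj, dif_pos (lt_of_lt_of_le i.2 hk)]
    rfl
  rw [Pi.smul_apply, h1, pathWeight_sub_ballot, add_sub_cancel_left, perturbedStep_smul,
    smul_eq_mul, mul_inv_cancel_left₀ hs]

theorem measurable_proj (k N : ℕ) : Measurable (proj k : (Fin N → ℝ) → Fin k → ℝ) := by
  refine measurable_pi_lambda _ fun i => ?_
  unfold proj
  split_ifs with h
  · exact measurable_pi_apply _
  · exact measurable_const

theorem tendsto_map_normalizedVector {γ : ℕ → ℝ} (k : ℕ)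
    {κ : ℕ → ProbabilityMeasure (EuclideanSpace ℝ (Fin k))}
    (hγ : ∀ k, 1 ≤ k → -1 < γ k)
    (hκ : ∀ᶠ n in atTop, (κ n : Measure (EuclideanSpace ℝ (Fin k))) =
      (Measure.pi fun i : Fin (2 * n - 1) => coeffLaw γ n i).map (normalizedVector k n)) :
    Tendsto κ atTop (𝓝 ⟨multivariateGaussian 0 1, inferInstance⟩) := by
  refine ProbabilityMeasure.tendsto_iff_tendsto_charFun.2 fun t => ?_
  rw [ProbabilityMeasure.coe_mk, multivariateGaussian_zero_one, ← map_pi_eq_stdGaussian,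
    charFun_pi]
  refine (tendsto_finsetProd _ fun (i : Fin k) _ =>
    tendsto_charFun_normalize γ i (t i)).congr' ?_
  filter_upwards [hκ, eventually_ge_atTop k, eventually_ge_atTop 1] with n h1 h2 h3
  have hk : k ≤ 2 * n - 1 := by omega
  have : ∀ i : Fin k, IsProbabilityMeasure ((coeffLaw γ n i).map (normalize n i)) := fun i =>
    have := isProbabilityMeasure_coeffLaw hγ (lt_of_lt_of_le i.2 hk)
    Measure.isProbabilityMeasure_map (measurable_normalize n i).aemeasurable
  rw [h1, map_normalizedVector hγ hk, charFun_pi]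

end RandomMoments

end

open RandomMoments in
theorem mainTheorem2
    (γ : ℕ → ℝ) (hγ : ∀ k, 1 ≤ k → -1 < γ k)
    {Ω : ℕ → Type*} [∀ n, MeasurableSpace (Ω n)]
    (P : (n : ℕ) → Measure (Ω n)) [∀ n, IsProbabilityMeasure (P n)]
    (M : (n : ℕ) → Ω n → (Fin (2 * n - 1) → ℝ))
    (hM : ∀ n, 1 ≤ n → HasLaw (M n)
      (RandomMoments.momentLaw γ (fun j => if Odd j then (n : ℝ) else 2 * n) n) (P n))
    (k : ℕ) :
    (∀ i : Fin k, RandomMoments.semicircleMoments k i =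
      if Even ((i : ℕ) + 1) then
        1 / ((((i : ℕ) + 1) / 2 : ℕ) + 1 : ℝ) *
          ((2 * (((i : ℕ) + 1) / 2)).choose (((i : ℕ) + 1) / 2) : ℝ)
      else 0) ∧
    IsUnit (RandomMoments.matD k).det ∧
    TendstoInDistribution
      (fun (n : ℕ) (ω : Ω n) => WithLp.toLp 2
        (√(2 * n : ℝ) • ((RandomMoments.matD k)⁻¹ *ᵥ
          (RandomMoments.proj k (M n ω) - RandomMoments.semicircleMoments k))))
      atTop (id : EuclideanSpace ℝ (Fin k) → EuclideanSpace ℝ (Fin k)) P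
      (multivariateGaussian 0 1) := by
  refine ⟨fun i => ?_, by simp [det_matD], ?_⟩
  · rw [semicircleMoments]
    split_ifs with h
    · obtain ⟨m, hm⟩ := even_iff_exists_two_mul.1 h
      rw [hm, integral_pow_two_mul_semicircle, show 2 * m / 2 = m by omega]
    · rw [integral_pow_semicircle,
        integral_pow_mul_sqrt_of_odd (Nat.not_even_iff_odd.1 h), mul_zero]
  set F : (n : ℕ) → (Fin (2 * n - 1) → ℝ) → EuclideanSpace ℝ (Fin k) := fun n m =>
    WithLp.toLp 2 (√(2 * n : ℝ) • ((matD k)⁻¹ *ᵥ (proj k m - semicircleMoments k))) with hF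
  have hFm : ∀ n, Measurable (F n) := by
    intro n
    have h0 : Continuous fun v : Fin k → ℝ => (matD k)⁻¹ *ᵥ (v - semicircleMoments k) :=
      Continuous.matrix_mulVec continuous_const (continuous_id.sub continuous_const)
    have h0' := h0.const_smul √(2 * n : ℝ)
    have h1 : Continuous fun v : Fin k → ℝ => (WithLp.toLp 2 (√(2 * n : ℝ) • ((matD k)⁻¹ *ᵥ
        (v - semicircleMoments k))) : EuclideanSpace ℝ (Fin k)) :=
      (PiLp.continuous_toLp 2 _).comp h0'
    exact h1.measurable.comp (measurable_proj k _)
  have hMm : ∀ n, AEMeasurable (M n) (P n) := by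
    intro n
    -- The hypothesis on the law starts at n = 1; for n = 0 the target is a one-point space.
    rcases Nat.eq_zero_or_pos n with rfl | hn
    · have : Subsingleton (Fin (2 * 0 - 1) → ℝ) := inferInstanceAs (Subsingleton (Fin 0 → ℝ))
      exact (measurable_of_subsingleton_codomain _).aemeasurable
    · exact (hM n hn).aemeasurable
  have hXm : ∀ n, AEMeasurable (fun ω => F n (M n ω)) (P n) := fun n =>
    (hFm n).comp_aemeasurable (hMm n)
  have hpi : ∀ n, IsProbabilityMeasure (Measure.pi fun i : Fin (2 * n - 1) => coeffLaw γ n i) := by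
    intro n
    have : ∀ i : Fin (2 * n - 1), IsProbabilityMeasure (coeffLaw γ n i) :=
      fun i => isProbabilityMeasure_coeffLaw hγ i.2
    infer_instance
  set κ : ℕ → ProbabilityMeasure (EuclideanSpace ℝ (Fin k)) := fun n =>
    ⟨(Measure.pi fun i : Fin (2 * n - 1) => coeffLaw γ n i).map (normalizedVector k n),
      Measure.isProbabilityMeasure_map (measurable_normalizedVector k n _).aemeasurable⟩ with hκ
  have hκlim := tendsto_map_normalizedVector k (κ := κ) hγ (Eventually.of_forall fun n => rfl)
  set G : EuclideanSpace ℝ (Fin k) × ℝ → EuclideanSpace ℝ (Fin k) := fun p =>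
    WithLp.toLp 2 ((matD k)⁻¹ *ᵥ fun i : Fin k =>
      perturbedStep (freeCoeff + p.2 • zeroExtend p.1.ofLp) (zeroExtend p.1.ofLp) i) with hG
  have hGc : Continuous G := continuous_remainder k
  have hε : Tendsto (fun n : ℕ => (√(2 * n : ℝ))⁻¹) atTop (𝓝 0) :=
    tendsto_inv_atTop_zero.comp (Real.tendsto_sqrt_atTop.comp
      (tendsto_natCast_atTop_atTop.const_mul_atTop two_pos))
  -- The deterministic parameter enters as a Dirac factor: κ_n ⊗ δ_{1/√(2n)} converges to N(0, I) ⊗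
  -- δ_0, and G is continuous on the product.
  have hlim := ProbabilityMeasure.tendsto_map_of_tendsto_of_continuous _ _
    ((ProbabilityMeasure.continuous_prod.tendsto _).comp
      (hκlim.prodMk_nhds ((continuous_diracProba.tendsto (0 : ℝ)).comp hε))) hGc
  have hdirac : ∀ (μ : Measure (EuclideanSpace ℝ (Fin k))) [IsProbabilityMeasure μ] (e : ℝ),
      (μ.prod (Measure.dirac e)).map G = μ.map fun z => G (z, e) := by
    intro μ _ e
    rw [Measure.prod_dirac, Measure.map_map hGc.measurable (by fun_prop)]
    rfl
  refine ⟨hXm, aemeasurable_id, ?_⟩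
  have hG0 : (fun z => G (z, 0)) = id := by
    ext1 z
    simp only [hG, zero_smul, add_zero, inv_matD_mulVec_perturbedStep_freeCoeff, id]
  refine (hlim.congr' ?_).mono_right (le_of_eq (congrArg 𝓝 (Subtype.ext ?_)))
  · filter_upwards [eventually_ge_atTop k, eventually_ge_atTop 1] with n h2 h3
    refine Subtype.ext ?_
    change ((κ n : Measure _).prod (Measure.dirac (√(2 * n : ℝ))⁻¹)).map G =
      (P n).map fun ω => F n (M n ω)
    have hlaw := hM n h3
    -- That h has total mass 1 is inherited from the assumption that it is the law of a random
    -- vector.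
    have : IsProbabilityMeasure
        (momentLaw γ (fun j => if Odd j then (n : ℝ) else 2 * n) n) := by
      rw [← hlaw.map_eq]
      exact Measure.isProbabilityMeasure_map hlaw.aemeasurable
    have hT : Measurable (momentMap (2 * n - 1)) := (contDiff_momentMap _).continuous.measurable
    have h4 : (P n).map (fun ω => F n (M n ω)) = ((P n).map (M n)).map (F n) :=
      (AEMeasurable.map_map_of_aemeasurable (hFm n).aemeasurable hlaw.aemeasurable).symm
    rw [hdirac, h4, hlaw.map_eq, momentLaw_eq_map hγ h3, Measure.map_map (hFm n) hT, hκ,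
      ProbabilityMeasure.coe_mk,
      Measure.map_map (by fun_prop) (measurable_normalizedVector k n _)]
    congr 1
    ext1 x
    simp only [Function.comp_apply, hF, hG]
    rw [normalized_proj_momentMap h3 (by omega)]
  · change ((multivariateGaussian 0 1).prod (Measure.dirac 0)).map G = _
    rw [hdirac, hG0]
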